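/- Fix an integer $d\ge 3$. For a prime $p$ and $\mathbf x\in\mathbb F_p^d$ let $\Phi(\mathbf x)=(k_0,\dots,k_{p-1})$, where $k_j$ is the number of coordinates of $\mathbf x$ equal to $j$. Let $\mathcal U_{d,p}$ be the multiset $\{\Phi(\mathbf x):\mathbf x\in\mathbb F_p^d,\ x_1+\dots+x_d=0\}$ (of size $p^{d-1}$), and let $X_1,X_2,\dots$ be independent and uniformly distributed over $\mathcal U_{d,p}$. For $b>0$ let $\mathcal N=\mathcal N_b(n,p)$ be the set of tuples $(n_0,\dots,n_{p-1})$ of nonnegative integers with $\sum_j n_j=n$ such that $(n_0,\dots,n_{p-1})\ne(n,0,\dots,0)$ and $$\sum_{j=0}^{p-1}\Big(\frac{n_j}{n}-\frac1p\Big)^2>\frac{b\log n}{n}$$ (that is, the tuple is not equidistributed). **Proposition 2.3 (deviation estimate for the error term).** There is $b_0>0$, depending only on $d$, such that for every $b\ge b_0$ and every $\varepsilon>0$, $$\sum_{(n_0,\dots,n_{p-1})\in\mathcal N}\binom{n}{n_0,\dots,n_{p-1}}\frac{p^{(d-1)n}\prod_{j=0}^{p-1}(dn_j)!}{(dn)!}\,\mathbb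 P\big(X_1+\dots+X_n=(dn_0,\dots,dn_{p-1})\big)=o(1)$$ as $n\to\infty$, uniformly over all primes $p\le n^{1/3-\varepsilon}$ with $p\nmid d$. -/

import Mathlib

open Finset MeasureTheory

noncomputable section

/-- The count vector `Φ(x) = (n_j)_{j ∈ ℤ/p}` of a vector `x` over `ℤ/p`:
`n_j` is the number of coordinates of `x` equal to `j`. -/
def countVector {p d : ℕ} (x : Fin d → ZMod p) : ZMod p → ℕ :=
  fun j => #{i | x i = j}

/-- The multiset `U_{d,p} = {Φ(x) : x ∈ (ℤ/p)^d, x_1 + ⋯ + x_d = 0}`; its elements are counted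
with multiplicity, one for each `x`. -/
def zeroSumCounts (d p : ℕ) [NeZero p] : Multiset (ZMod p → ℕ) :=
  ({x : Fin d → ZMod p | ∑ i, x i = 0} : Finset (Fin d → ZMod p)).val.map countVector

theorem zeroSumCounts_ne_zero (d p : ℕ) [NeZero p] : zeroSumCounts d p ≠ 0 := by
  have h0 : (0 : Fin d → ZMod p) ∈
      ({x : Fin d → ZMod p | ∑ i, x i = 0} : Finset (Fin d → ZMod p)).val := by simp
  have h1 : countVector 0 ∈ zeroSumCounts d p := Multiset.mem_map_of_mem countVector h0
  intro h
  rw [h] at h1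
  exact Multiset.notMem_zero _ h1

/-- The law of one step `X`, uniformly distributed over the multiset `U_{d,p}`. -/
def stepLaw (d p : ℕ) [NeZero p] : PMF (ZMod p → ℕ) :=
  PMF.ofMultiset (zeroSumCounts d p) (zeroSumCounts_ne_zero d p)

/-- The probability `ℙ(X_1 + ⋯ + X_n = y)`, where `X_1, …, X_n` are independent copies of `X`,
realized as the coordinates on the `n`-fold product of the law of `X`. -/
def walkProb (d p n : ℕ) [NeZero p] (y : ZMod p → ℕ) : ℝ :=
  (Measure.pi fun _ : Fin n => (stepLaw d p).toMeasure).real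
    {w : Fin n → ZMod p → ℕ | ∑ i, w i = y}

/-- The summand of the total sum that belongs to the count vector `N = (n_0, …, n_{p-1})`:
`binom(n; n_0, …, n_{p-1}) * p^((d-1)n) * ∏_j (d n_j)! / (dn)! * ℙ(X_1 + ⋯ + X_n = d N)`. -/
def contribution (d p n : ℕ) [NeZero p] (N : ZMod p → ℕ) : ℝ :=
  (Nat.multinomial univ N : ℝ) *
    ((p : ℝ) ^ ((d - 1) * n) * (∏ j, ((d * N j).factorial : ℝ)) / ((d * n).factorial : ℝ)) *
    walkProb d p n (d • N)

/-- `N = (n_0, …, n_{p-1})` is equidistributed (with parameter `b`):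
`∑_j (n_j / n - 1 / p)^2 ≤ b log n / n`. -/
def Equidistributed (b : ℝ) (p n : ℕ) [NeZero p] (N : ZMod p → ℕ) : Prop :=
  ∑ j, ((N j : ℝ) / n - 1 / p) ^ 2 ≤ b * Real.log n / n

open Classical in
/-- The set of `p`-tuples of nonnegative integers with sum `n` that are neither `(n, 0, …, 0)`
nor equidistributed. -/
def errorTuples (b : ℝ) (p n : ℕ) [NeZero p] : Finset (ZMod p → ℕ) :=
  {N ∈ piAntidiag univ n | N ≠ Pi.single 0 n ∧ ¬ Equidistributed b p n N}

end

/-! Put `q j = N j / n`. Chernoff's bound for the walk, with a free nonnegative weight `x`, combined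
with Stirling's formula, bounds each contribution by `√d ^ #supp N * ∏ q j ^ ((d-1) N j) * F(x) ^ n
/ ∏ x j ^ (d N j)`, where `F` is `zeroSumPoly` (`contribution_mul_le`). Two choices of `x` are used.

The choice `x = q ^ ((d-1)/d)` cancels the entropy term exactly, and Young's inequality for
convolutions gives `F(x) ≤ 1`. Its proof by AM-GM over zero-sum words leaves a remainder: the
average Hellinger distance between `q` and its reflections. This is small only if `q` is nearly
uniform or nearly the point mass at 0; a point mass at `k ≠ 0` is excluded because `p ∤ d`
(`min_le_sum_prod_mul_reflDist`). Away from these two cases a contribution is at most `(d / n^4) ^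
p`, which beats the `(n+1) ^ p` tuples; the requirement is that `p^3 log n` be small against `n`.

Near `(n, 0, …, 0)` the factor `√d ^ p` is too costly. There the choice `x 0 = 1`, `x j = √(q j)`
bounds a contribution with `m = n - N 0` by `(A √(m/n)) ^ m` (`contribution_le_pow`). At most `p ^
m` tuples share the same `m`, so the sum over `m ≥ 1` is dominated by a geometric-type series of
size `O(p/√n)`. -/

noncomputable section

/-! ### Generating polynomial and Chernoff bound. -/

/-- The generating polynomial of the multiset `U_{d,p}`: the sum of `∏ x (w i)` over all words `w`
of length `d` whose letters sum to zero. -/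
def zeroSumPoly (d p : ℕ) [NeZero p] (x : ZMod p → ℝ) : ℝ :=
  ∑ w : Fin d → ZMod p with ∑ i, w i = 0, ∏ i, x (w i)

theorem zeroSumPoly_nonneg {d p : ℕ} [NeZero p] {x : ZMod p → ℝ} (hx : ∀ j, 0 ≤ x j) :
    0 ≤ zeroSumPoly d p x :=
  sum_nonneg fun _ _ => prod_nonneg fun _ _ => hx _

/-- Any one letter of a zero-sum word is determined by the others. The position `i` is kept free
because Young's inequality omits each letter in turn. -/
theorem sum_zeroSum {p e : ℕ} [NeZero p] (i : Fin (e + 1)) (Φ : (Fin (e + 1) → ZMod p) → ℝ) :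
    ∑ w : Fin (e + 1) → ZMod p with ∑ l, w l = 0, Φ w
      = ∑ v : Fin e → ZMod p, Φ (i.insertNth (-∑ l, v l) v) := by
  refine sum_nbij' (fun w => i.removeNth w) (fun v => i.insertNth (-∑ l, v l) v) ?_ ?_ ?_ ?_ ?_
  · simp
  · intro v _
    simp [Fin.sum_univ_succAbove _ i]
  · intro w hw
    have h : w i = -∑ l, i.removeNth w l := by
      simp only [mem_filter, mem_univ, true_and, Fin.sum_univ_succAbove _ i] at hw
      exact eq_neg_of_add_eq_zero_left hw
    rw [← h, Fin.insertNth_self_removeNth]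
  · intro v _
    simp
  · intro w hw
    have h : w i = -∑ l, i.removeNth w l := by
      simp only [mem_filter, mem_univ, true_and, Fin.sum_univ_succAbove _ i] at hw
      exact eq_neg_of_add_eq_zero_left hw
    rw [← h, Fin.insertNth_self_removeNth]

theorem card_zeroSumCounts (e p : ℕ) [NeZero p] :
    Multiset.card (zeroSumCounts (e + 1) p) = p ^ e := by
  have h := sum_zeroSum (p := p) (0 : Fin (e + 1)) fun _ => 1
  simp only [sum_const, nsmul_eq_mul, mul_one, card_univ, Fintype.card_pi, ZMod.card,
    prod_const, Fintype.card_fin] at h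
  have h' : (({w : Fin (e + 1) → ZMod p | ∑ l, w l = 0} : Finset _).card) = p ^ e := by
    exact_mod_cast h
  rw [zeroSumCounts, Multiset.card_map]
  exact h'

theorem prod_pow_countVector {p d : ℕ} [NeZero p] (x : ZMod p → ℝ) (w : Fin d → ZMod p) :
    ∏ j, x j ^ countVector w j = ∏ i, x (w i) := by
  rw [← prod_fiberwise_of_maps_to (s := univ) (t := univ) (g := w) (fun _ _ => mem_univ _)]
  refine prod_congr rfl fun j _ => ?_
  rw [countVector, ← prod_const]
  exact prod_congr rfl fun i hi => by rw [(mem_filter.1 hi).2]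

theorem integrable_stepLaw (d p : ℕ) [NeZero p] (f : (ZMod p → ℕ) → ℝ) :
    Integrable f (stepLaw d p).toMeasure := by
  classical
  refine Integrable.of_bound (C := ∑ a ∈ (zeroSumCounts d p).toFinset, |f a|)
    (Measurable.of_discrete.aestronglyMeasurable) ?_
  rw [ae_iff, PMF.toMeasure_apply_eq_zero_iff _ (MeasurableSet.of_discrete), Set.disjoint_left]
  intro a ha h
  apply h
  rw [stepLaw, PMF.support_ofMultiset] at ha
  rw [Real.norm_eq_abs]
  exact single_le_sum (f := fun a => |f a|) (fun _ _ => abs_nonneg _) (by simpa using ha)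

theorem integral_stepLaw (e p : ℕ) [NeZero p] (x : ZMod p → ℝ) :
    ∫ X, ∏ j, x j ^ X j ∂(stepLaw (e + 1) p).toMeasure = zeroSumPoly (e + 1) p x / p ^ e := by
  classical
  rw [PMF.integral_eq_tsum _ _ (integrable_stepLaw _ _ _),
    tsum_eq_sum (s := (zeroSumCounts (e + 1) p).toFinset)]
  · have h1 : zeroSumPoly (e + 1) p x
        = ((zeroSumCounts (e + 1) p).map fun X => ∏ j, x j ^ X j).sum := by
      simp [zeroSumCounts, zeroSumPoly, prod_pow_countVector, Finset.sum]
    rw [h1, Finset.sum_multiset_map_count, sum_div]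
    refine sum_congr rfl fun X _ => ?_
    have hX : (stepLaw (e + 1) p X).toReal
        = ((zeroSumCounts (e + 1) p).count X : ℝ) / (p : ℝ) ^ e := by
      rw [stepLaw, PMF.ofMultiset_apply, card_zeroSumCounts]
      simp only [ENNReal.toReal_div, ENNReal.toReal_natCast, Nat.cast_pow, ENNReal.toReal_pow]
      congr!
    rw [hX, smul_eq_mul, nsmul_eq_mul, div_mul_eq_mul_div]
  · intro X hX
    rw [stepLaw, PMF.ofMultiset_apply_of_notMem]
    · simp
    · simpa using hX

/-- The Chernoff bound for the walk, in terms of the generating polynomial of the steps. -/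
theorem walkProb_mul_le (e p n : ℕ) [NeZero p] {x : ZMod p → ℝ} (hx : ∀ j, 0 ≤ x j)
    (y : ZMod p → ℕ) :
    walkProb (e + 1) p n y * (p : ℝ) ^ (e * n) * ∏ j, x j ^ y j
      ≤ zeroSumPoly (e + 1) p x ^ n := by
  set ν := Measure.pi fun _ : Fin n => (stepLaw (e + 1) p).toMeasure with hν
  let f : (Fin n → ZMod p → ℕ) → ℝ := fun w => ∏ i, ∏ j, x j ^ w i j
  have hint : Integrable f ν :=
    Integrable.fintype_prod_dep (𝕜 := ℝ) (E := fun _ : Fin n => ZMod p → ℕ)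
      (μ := fun _ => (stepLaw (e + 1) p).toMeasure)
      (f := fun _ X => ∏ j, x j ^ X j) fun _ => integrable_stepLaw (e + 1) p _
  have hval : ∫ w, f w ∂ν = (zeroSumPoly (e + 1) p x / p ^ e) ^ n := by
    have := integral_fintype_prod_eq_prod (𝕜 := ℝ) (ι := Fin n)
      (μ := fun _ => (stepLaw (e + 1) p).toMeasure) (fun _ X => ∏ j, x j ^ X j)
    rw [integral_stepLaw] at this
    simpa [f, hν, div_pow] using this
  have hf : ∀ w, 0 ≤ f w := fun w => prod_nonneg fun _ _ => prod_nonneg fun _ _ => pow_nonneg (hx _) _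
  -- Markov's inequality: on the event that the walk ends at `y`, the weight `f` equals `∏ j, x j ^
  -- y j`.
  have hmark := mul_meas_ge_le_integral_of_nonneg (μ := ν) (ae_of_all _ hf) hint
    (∏ j, x j ^ y j)
  have hsub : {w : Fin n → ZMod p → ℕ | ∑ i, w i = y} ⊆ {w | ∏ j, x j ^ y j ≤ f w} := by
    rintro w rfl
    simp only [Set.mem_ofPred_eq, f]
    rw [prod_comm]
    exact le_of_eq (prod_congr rfl fun j _ => by rw [prod_pow_eq_pow_sum, Finset.sum_apply])
  have hle : walkProb (e + 1) p n y ≤ ν.real {w | ∏ j, x j ^ y j ≤ f w} :=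
    measureReal_mono hsub
  have hp : (0 : ℝ) < p := by exact_mod_cast Nat.pos_of_ne_zero (NeZero.ne p)
  rw [hval, div_pow, ← pow_mul, le_div_iff₀ (by positivity)] at hmark
  calc _ = (∏ j, x j ^ y j) * walkProb (e + 1) p n y * (p : ℝ) ^ (e * n) := by ring
    _ ≤ (∏ j, x j ^ y j) * ν.real {w | ∏ j, x j ^ y j ≤ f w} * (p : ℝ) ^ (e * n) := by
        have : 0 ≤ ∏ j, x j ^ y j := prod_nonneg fun _ _ => pow_nonneg (hx _) _
        gcongr
    _ ≤ _ := hmark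

/-! ### Stirling bounds for the factorial ratio. -/

theorem factorial_eq_stirlingSeq_mul {k : ℕ} (hk : k ≠ 0) :
    (k.factorial : ℝ) = Stirling.stirlingSeq k * (√(2 * k) * (k / Real.exp 1) ^ k) := by
  have : (0 : ℝ) < k := by exact_mod_cast Nat.pos_of_ne_zero hk
  rw [Stirling.stirlingSeq, div_mul_cancel₀]
  positivity

theorem stirlingSeq_antitone {k l : ℕ} (hk : k ≠ 0) (h : k ≤ l) :
    Stirling.stirlingSeq l ≤ Stirling.stirlingSeq k := by
  obtain ⟨k, rfl⟩ := Nat.exists_eq_succ_of_ne_zero hk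
  obtain ⟨l, rfl⟩ := Nat.exists_eq_succ_of_ne_zero (by omega : l ≠ 0)
  exact Stirling.stirlingSeq'_antitone (by omega)

/-- The exponential rate of `(d k)! / (k! k^((d-1)k))`. -/
def factorialRate (d : ℕ) : ℝ := d ^ d / Real.exp 1 ^ (d - 1)

theorem factorialRate_pos {d : ℕ} (hd : d ≠ 0) : 0 < factorialRate d := by
  have : (0 : ℝ) < d := by exact_mod_cast Nat.pos_of_ne_zero hd
  rw [factorialRate]
  positivity

theorem factorialRate_pow_mul {d k : ℕ} (hd : d ≠ 0) :
    factorialRate d ^ k * (k : ℝ) ^ ((d - 1) * k) * (k / Real.exp 1) ^ k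
      = ((d * k : ℕ) / Real.exp 1) ^ (d * k) := by
  obtain ⟨e, rfl⟩ := Nat.exists_eq_succ_of_ne_zero hd
  rw [factorialRate]
  simp only [Nat.succ_eq_add_one, Nat.add_sub_cancel, pow_mul, ← mul_pow]
  congr 1
  have := Real.exp_ne_zero 1
  push_cast
  simp only [div_pow, mul_pow, pow_succ]
  field_simp

/-- The Stirling ratio decreases, so the only loss is the `√d` from `√(2dk)`. -/
theorem factorial_mul_le {d k : ℕ} (hd : d ≠ 0) (hk : k ≠ 0) :
    ((d * k).factorial : ℝ)
      ≤ √d * (k.factorial * (factorialRate d ^ k * (k : ℝ) ^ ((d - 1) * k))) := by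
  have hk' : (0 : ℝ) < k := by exact_mod_cast Nat.pos_of_ne_zero hk
  rw [factorial_eq_stirlingSeq_mul hk, factorial_eq_stirlingSeq_mul (mul_ne_zero hd hk),
    ← factorialRate_pow_mul hd]
  have h1 : √(2 * ((d * k : ℕ) : ℝ)) = √d * √(2 * k) := by
    rw [← Real.sqrt_mul (Nat.cast_nonneg d)]
    push_cast
    ring_nf
  have h2 := stirlingSeq_antitone hk (Nat.le_mul_of_pos_left k (Nat.pos_of_ne_zero hd))
  have := factorialRate_pos hd
  rw [h1]
  calc _ ≤ Stirling.stirlingSeq k * (√d * √(2 * k) *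
        (factorialRate d ^ k * (k : ℝ) ^ ((d - 1) * k) * (k / Real.exp 1) ^ k)) := by gcongr
    _ = _ := by ring

/-- Without any constant: the `√d` from `√(2dn)` absorbs the total decrease of the Stirling ratio
from `e/√2` to `√π`. -/
theorem le_factorial_mul {d n : ℕ} (hd : 3 ≤ d) (hn : n ≠ 0) :
    n.factorial * (factorialRate d ^ n * (n : ℝ) ^ ((d - 1) * n)) ≤ ((d * n).factorial : ℝ) := by
  have hn' : (0 : ℝ) < n := by exact_mod_cast Nat.pos_of_ne_zero hn
  have hd0 : d ≠ 0 := by omega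
  rw [factorial_eq_stirlingSeq_mul hn, factorial_eq_stirlingSeq_mul (mul_ne_zero hd0 hn),
    ← factorialRate_pow_mul hd0]
  have h1 : √(2 * ((d * n : ℕ) : ℝ)) = √d * √(2 * n) := by
    rw [← Real.sqrt_mul (Nat.cast_nonneg d)]
    push_cast
    ring_nf
  have h2 : Stirling.stirlingSeq n ≤ Stirling.stirlingSeq (d * n) * √d := by
    calc Stirling.stirlingSeq n ≤ Stirling.stirlingSeq 1 :=
          stirlingSeq_antitone one_ne_zero (Nat.one_le_iff_ne_zero.2 hn)
      _ = Real.exp 1 / √2 := Stirling.stirlingSeq_one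
      _ ≤ √Real.pi * √3 := by
          rw [div_le_iff₀ (by positivity), ← Real.sqrt_mul (by positivity),
            ← Real.sqrt_mul (by positivity)]
          apply Real.le_sqrt_of_sq_le
          nlinarith [Real.exp_one_lt_d9, Real.pi_gt_three, Real.exp_pos 1]
      _ ≤ _ := by
          gcongr
          · exact Real.sqrt_nonneg _ |>.trans (Stirling.sqrt_pi_le_stirlingSeq (mul_ne_zero hd0 hn))
          · exact Stirling.sqrt_pi_le_stirlingSeq (mul_ne_zero hd0 hn)
          · exact_mod_cast hd
  have := factorialRate_pos hd0
  rw [h1]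
  calc _ = Stirling.stirlingSeq n * (√(2 * n) *
        (factorialRate d ^ n * (n : ℝ) ^ ((d - 1) * n) * (n / Real.exp 1) ^ n)) := by ring
    _ ≤ Stirling.stirlingSeq (d * n) * √d * (√(2 * n) *
        (factorialRate d ^ n * (n : ℝ) ^ ((d - 1) * n) * (n / Real.exp 1) ^ n)) := by gcongr
    _ = _ := by ring

/-- The ratio of a multinomial coefficient to its `d`-fold dilation, compared with the entropy
term up to a factor for each letter that occurs. -/
theorem multinomial_mul_prod_factorial_le {d n p : ℕ} [NeZero p] (hd : 3 ≤ d) (hn : n ≠ 0)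
    {N : ZMod p → ℕ} (hN : ∑ j, N j = n) :
    (Nat.multinomial univ N : ℝ) * ((∏ j, ((d * N j).factorial : ℝ)) / ((d * n).factorial : ℝ))
      ≤ √d ^ #{j | N j ≠ 0} * ∏ j, ((N j : ℝ) / n) ^ ((d - 1) * N j) := by
  have hd0 : d ≠ 0 := by omega
  have hn' : (0 : ℝ) < n := by exact_mod_cast Nat.pos_of_ne_zero hn
  have hR := factorialRate_pos hd0
  have h1 : ∏ j, ((d * N j).factorial : ℝ) ≤ √d ^ #{j | N j ≠ 0} *
      ((∏ j, ((N j).factorial : ℝ)) * (factorialRate d ^ n * ∏ j, (N j : ℝ) ^ ((d - 1) * N j))) := by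
    rw [← hN, ← prod_pow_eq_pow_sum, ← prod_mul_distrib, ← prod_mul_distrib, ← prod_const,
      prod_filter, ← prod_mul_distrib]
    refine prod_le_prod (fun _ _ => by positivity) fun j _ => ?_
    split_ifs with h
    · exact factorial_mul_le hd0 h
    · rw [not_not] at h
      simp [h]
  have h2 : (∏ j, ((N j).factorial : ℝ)) * Nat.multinomial univ N = n.factorial := by
    have := Nat.multinomial_spec univ N
    rw [hN] at this
    exact_mod_cast this
  have h3 := le_factorial_mul hd hn
  have h4 : ∏ j, ((N j : ℝ) / n) ^ ((d - 1) * N j)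
      = (∏ j, (N j : ℝ) ^ ((d - 1) * N j)) / (n : ℝ) ^ ((d - 1) * n) := by
    simp only [div_pow, prod_div_distrib, prod_pow_eq_pow_sum, ← mul_sum, hN]
  have hpos : (0 : ℝ) < (d * n).factorial := by exact_mod_cast Nat.factorial_pos _
  rw [h4, mul_div_assoc', div_le_iff₀ hpos]
  set P : ℝ := ∏ j, (N j : ℝ) ^ ((d - 1) * N j)
  have hP : 0 ≤ P := prod_nonneg fun _ _ => by positivity
  calc _ ≤ (Nat.multinomial univ N : ℝ) * (√d ^ #{j | N j ≠ 0} *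
          ((∏ j, ((N j).factorial : ℝ)) * (factorialRate d ^ n * P))) := by gcongr
    _ = √d ^ #{j | N j ≠ 0} * (P / (n : ℝ) ^ ((d - 1) * n)) *
          (((∏ j, ((N j).factorial : ℝ)) * Nat.multinomial univ N) *
            (factorialRate d ^ n * (n : ℝ) ^ ((d - 1) * n))) := by
        field_simp
    _ ≤ _ := by
        rw [h2]
        gcongr

/-- The factor `p ^ ((d-1) n)` cancels the normalization of the step law. The weight `x` stays free,
to be chosen differently near and far from the point mass. -/
theorem contribution_mul_le {d n p : ℕ} [NeZero p] (hd : 3 ≤ d) (hn : n ≠ 0)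
    {N : ZMod p → ℕ} (hN : ∑ j, N j = n) {x : ZMod p → ℝ} (hx : ∀ j, 0 ≤ x j) :
    contribution d p n N * ∏ j, x j ^ (d * N j)
      ≤ √d ^ #{j | N j ≠ 0} * (∏ j, ((N j : ℝ) / n) ^ ((d - 1) * N j)) *
        zeroSumPoly d p x ^ n := by
  obtain ⟨e, rfl⟩ : ∃ e, d = e + 1 := ⟨d - 1, by omega⟩
  have h1 := walkProb_mul_le e p n hx ((e + 1) • N)
  have h2 := multinomial_mul_prod_factorial_le hd hn hN
  simp only [Pi.smul_apply, smul_eq_mul] at h1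
  have h0 : 0 ≤ walkProb (e + 1) p n ((e + 1) • N) * (p : ℝ) ^ (e * n) *
      ∏ j, x j ^ ((e + 1) * N j) :=
    mul_nonneg (mul_nonneg measureReal_nonneg (by positivity))
      (prod_nonneg fun _ _ => pow_nonneg (hx _) _)
  calc _ = (Nat.multinomial univ N : ℝ) * ((∏ j, (((e + 1) * N j).factorial : ℝ)) /
        (((e + 1) * n).factorial : ℝ)) * (walkProb (e + 1) p n ((e + 1) • N) *
          (p : ℝ) ^ (e * n) * ∏ j, x j ^ ((e + 1) * N j)) := by
        rw [contribution, Nat.add_sub_cancel]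
        ring
    _ ≤ _ := by
      refine mul_le_mul h2 h1 h0 ?_
      exact mul_nonneg (by positivity) (prod_nonneg fun _ _ => by positivity)

/-! ### AM-GM and Young's inequality with a remainder. -/

theorem card_mul_prod_le_sum_pow {d : ℕ} (hd : d ≠ 0) {b : Fin d → ℝ} (hb : ∀ i, 0 ≤ b i) :
    d * ∏ i, b i ≤ ∑ i, b i ^ d := by
  have hd' : (0 : ℝ) < d := by exact_mod_cast Nat.pos_of_ne_zero hd
  have h := Real.geom_mean_le_arith_mean_weighted univ (fun _ => (d : ℝ)⁻¹) (fun i => b i ^ d)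
    (fun _ _ => by positivity) (by simp [hd]) (fun i _ => pow_nonneg (hb i) d)
  simp only [Real.pow_rpow_inv_natCast (hb _) hd, ← mul_sum] at h
  rwa [inv_mul_eq_div, le_div_iff₀ hd', mul_comm] at h

/-- The inequality of arithmetic and geometric means with a remainder. -/
theorem card_mul_prod_le_sum_pow_sub {e : ℕ} {b : Fin (e + 2) → ℝ} (hb : ∀ i, 0 ≤ b i) :
    ((e + 2 : ℕ) : ℝ) * ∏ i, b i
      ≤ ∑ i, b i ^ (e + 2) - (√(b 0 ^ (e + 2)) - √(b 1 ^ (e + 2))) ^ 2 := by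
  have h01 := mul_nonneg (hb 0) (hb 1)
  -- Replacing `b 0` and `b 1` by their geometric mean keeps the product and lowers the sum of
  -- powers by exactly the remainder.
  have h := card_mul_prod_le_sum_pow (d := e + 2) (by omega)
    (b := Fin.cons √(b 0 * b 1) (Fin.cons √(b 0 * b 1) fun i : Fin e => b i.succ.succ)) (by
      intro i
      refine Fin.cases (by simp) (fun i => ?_) i
      refine Fin.cases (by simp) (fun i => ?_) i
      simpa using hb _)
  simp only [Fin.prod_univ_succ, Fin.sum_univ_succ, Fin.cons_zero, Fin.cons_succ] at h ⊢
  rw [← mul_assoc √(b 0 * b 1), Real.mul_self_sqrt h01] at h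
  have h2 : √(b 0 * b 1) ^ (e + 2) = √(b 0 ^ (e + 2)) * √(b 1 ^ (e + 2)) := by
    rw [← Real.sqrt_mul (pow_nonneg (hb 0) _), ← mul_pow]
    refine (Real.sqrt_eq_iff_mul_self_eq ?_ ?_).2 ?_ |>.symm
    · positivity
    · positivity
    · rw [← mul_pow, Real.mul_self_sqrt h01]
  have h3 := Real.sq_sqrt (pow_nonneg (hb 0) (e + 2))
  have h4 := Real.sq_sqrt (pow_nonneg (hb 1) (e + 2))
  rw [h2] at h
  simp only [Fin.succ_zero_eq_one] at h ⊢
  nlinarith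

theorem prod_compl_insertNth {p e : ℕ} (q : ZMod p → ℝ) (i : Fin (e + 1)) (a : ZMod p)
    (v : Fin e → ZMod p) :
    ∏ l ∈ {i}ᶜ, q ((i.insertNth a v : Fin (e + 1) → ZMod p) l) = ∏ l, q (v l) := by
  rw [← Fin.image_succAbove_univ, prod_image (fun _ _ _ _ h => Fin.succAbove_right_injective h)]
  simp

variable {p : ℕ} [NeZero p]

theorem sum_fin_succ_fun {e : ℕ} (Φ : (Fin (e + 1) → ZMod p) → ℝ) :
    ∑ v, Φ v = ∑ a, ∑ v, Φ (Fin.cons a v) := by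
  rw [← (Fin.consEquiv fun _ : Fin (e + 1) => ZMod p).sum_comp, Fintype.sum_prod_type]
  rfl

theorem sum_prod_word {q : ZMod p → ℝ} (hq1 : ∑ j, q j = 1) (e : ℕ) :
    ∑ v : Fin e → ZMod p, ∏ l, q (v l) = 1 := by
  induction e with
  | zero => simp
  | succ e ih => simp [sum_fin_succ_fun, Fin.prod_univ_succ, ← mul_sum, ih, hq1]

theorem prod_prod_compl {e : ℕ} (f : Fin (e + 1) → ℝ) :
    ∏ i, ∏ l ∈ {i}ᶜ, f l = ∏ l, f l ^ e := by
  rw [prod_comm' (t' := univ) (s' := fun l => {l}ᶜ) (by simp [eq_comm])]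
  refine prod_congr rfl fun l _ => ?_
  simp [card_compl]

/-- The squared Hellinger distance between `q` and its reflection `i ↦ t - i`. -/
def reflDist (q : ZMod p → ℝ) (t : ZMod p) : ℝ := ∑ i, (√(q i) - √(q (t - i))) ^ 2

theorem reflDist_nonneg (q : ZMod p → ℝ) (t : ZMod p) : 0 ≤ reflDist q t :=
  sum_nonneg fun _ _ => sq_nonneg _

/-- Young's inequality for the `d`-fold convolution on `ℤ/p` with a remainder term. -/
theorem zeroSumPoly_le_one_sub (e : ℕ) {q : ZMod p → ℝ} (hq : ∀ j, 0 ≤ q j)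
    (hq1 : ∑ j, q j = 1) :
    ((e + 2 : ℕ) : ℝ) * zeroSumPoly (e + 2) p (fun j => (q j ^ ((e + 2 : ℕ) : ℝ)⁻¹) ^ (e + 1))
      ≤ (e + 2 : ℕ) - ∑ v : Fin e → ZMod p, (∏ l, q (v l)) * reflDist q (-∑ l, v l) := by
  set z : ZMod p → ℝ := fun j => q j ^ ((e + 2 : ℕ) : ℝ)⁻¹ with hz
  have hz0 : ∀ j, 0 ≤ z j := fun j => Real.rpow_nonneg (hq j) _
  have hzq : ∀ j, z j ^ (e + 2) = q j := fun j =>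
    Real.rpow_inv_natCast_pow (hq j) (by omega)
  -- AM-GM for the products of `z` over all letters but one: each `z (w l)` occurs in `e + 1` of
  -- them, and their `(e+2)`-th powers are products of `q`.
  have hw : ∀ w : Fin (e + 2) → ZMod p, ((e + 2 : ℕ) : ℝ) * ∏ i, z (w i) ^ (e + 1)
      ≤ ∑ i, ∏ l ∈ {i}ᶜ, q (w l) -
        (√(∏ l ∈ {0}ᶜ, q (w l)) - √(∏ l ∈ {1}ᶜ, q (w l))) ^ 2 := by
    intro w
    have := card_mul_prod_le_sum_pow_sub (e := e) (b := fun i => ∏ l ∈ {i}ᶜ, z (w l))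
      fun i => prod_nonneg fun _ _ => hz0 _
    simpa only [prod_prod_compl (e := e + 1) fun l => z (w l), ← prod_pow, hzq] using this
  have h1 : ∑ w : Fin (e + 2) → ZMod p with ∑ l, w l = 0, ∑ i, ∏ l ∈ {i}ᶜ, q (w l)
      = (e + 2 : ℕ) := by
    rw [sum_comm]
    have : ∀ i : Fin (e + 2),
        ∑ w : Fin (e + 2) → ZMod p with ∑ l, w l = 0, ∏ l ∈ {i}ᶜ, q (w l) = 1 := fun i => by
      rw [sum_zeroSum i]
      simp only [prod_compl_insertNth, sum_prod_word hq1]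
    simp [this]
  -- Fix the letters `v` after the first two. If the second is `a`, the first is `-∑ v - a`, its
  -- reflection, and `∏ q (v l)` factors out of the square.
  have h2 : ∑ w : Fin (e + 2) → ZMod p with ∑ l, w l = 0,
      (√(∏ l ∈ {0}ᶜ, q (w l)) - √(∏ l ∈ {1}ᶜ, q (w l))) ^ 2
      = ∑ v : Fin e → ZMod p, (∏ l, q (v l)) * reflDist q (-∑ l, v l) := by
    rw [sum_zeroSum 0, sum_fin_succ_fun, sum_comm]
    refine sum_congr rfl fun v _ => ?_
    rw [reflDist, mul_sum]
    refine sum_congr rfl fun a _ => ?_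
    have hv : 0 ≤ ∏ l, q (v l) := prod_nonneg fun _ _ => hq _
    have e1 : (Fin.insertNth 0 (-∑ l, (Fin.cons a v : Fin (e + 1) → ZMod p) l) (Fin.cons a v) :
        Fin (e + 2) → ZMod p)
        = Fin.insertNth 1 a (Fin.cons (-∑ l, v l - a) v) := by
      funext l
      refine Fin.cases ?_ (fun l => ?_) l
      · have : (0 : Fin (e + 2)) = Fin.succAbove 1 0 := by simp
        rw [Fin.insertNth_apply_same]
        conv_rhs => rw [this, Fin.insertNth_apply_succAbove]
        simp [Fin.sum_univ_succ]
        ring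
      · rw [Fin.insertNth_zero, Fin.cons_succ]
        refine Fin.cases ?_ (fun l => ?_) l
        · simp
        · have : l.succ.succ = Fin.succAbove (1 : Fin (e + 2)) l.succ := by simp
          conv_rhs => rw [this, Fin.insertNth_apply_succAbove]
          simp
    rw [prod_compl_insertNth, e1, prod_compl_insertNth]
    simp only [Fin.prod_univ_succ, Fin.cons_zero, Fin.cons_succ]
    rw [Real.sqrt_mul (hq _), Real.sqrt_mul (hq _), ← sub_mul, mul_pow, Real.sq_sqrt hv, mul_comm]
  rw [zeroSumPoly, mul_sum]
  calc _ ≤ _ := sum_le_sum fun w _ => hw w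
    _ = _ := by rw [sum_sub_distrib, h1, h2]

/-! ### Stability: lower bounds for the averaged reflection distance. -/

theorem quarter_le_reflDist {q : ZMod p → ℝ} (hq : ∀ j, 0 ≤ q j) (hq1 : ∑ j, q j = 1)
    {k t : ZMod p} (hk : 15 / 16 < q k) (ht : t - k ≠ k) : 1 / 4 ≤ reflDist q t := by
  have h1 : q k + q (t - k) ≤ 1 := by
    rw [← hq1, ← sum_pair ht.symm]
    exact sum_le_sum_of_subset_of_nonneg (subset_univ _) fun _ _ _ => hq _
  have h2 : 3 / 4 ≤ √(q k) := Real.le_sqrt_of_sq_le (by norm_num; linarith)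
  have h3 : √(q (t - k)) ≤ 1 / 4 := Real.sqrt_le_iff.2 ⟨by norm_num, by norm_num; linarith⟩
  calc (1 / 4 : ℝ) ≤ (√(q k) - √(q (t - k))) ^ 2 := by nlinarith
    _ ≤ _ := single_le_sum (f := fun i => (√(q i) - √(q (t - i))) ^ 2)
      (fun _ _ => sq_nonneg _) (mem_univ k)

/-- The squared `ℓ²` distance between `h` and its translate by `c`. -/
def transDist (h : ZMod p → ℝ) (c : ZMod p) : ℝ := ∑ i, (h i - h (i + c)) ^ 2

/-- Two reflections compose to a translation; then `(a + b)² ≤ 2a² + 2b²`. -/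
theorem transDist_sub_le (q : ZMod p → ℝ) (t t' : ZMod p) :
    transDist (fun i => √(q i)) (t' - t) ≤ 2 * reflDist q t + 2 * reflDist q t' := by
  have h : reflDist q t' = ∑ i, (√(q (i + (t' - t))) - √(q (t - i))) ^ 2 := by
    rw [reflDist, ← Equiv.sum_comp (Equiv.addRight (t' - t))]
    refine sum_congr rfl fun i _ => ?_
    rw [Equiv.coe_addRight, show t' - (i + (t' - t)) = t - i by ring]
  rw [h, reflDist, transDist, mul_sum, mul_sum, ← sum_add_distrib]
  refine sum_le_sum fun i _ => ?_
  nlinarith [sq_nonneg (√(q i) - √(q (t - i)) + (√(q (i + (t' - t))) - √(q (t - i))))]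

/-- Telescoping along `k` translations by `c`, then Cauchy-Schwarz. -/
theorem transDist_nsmul_le (h : ZMod p → ℝ) (c : ZMod p) (k : ℕ) :
    transDist h (k * c) ≤ (k : ℝ) ^ 2 * transDist h c := by
  have h1 : ∀ i, (h i - h (i + k * c)) ^ 2
      ≤ k * ∑ l ∈ range k, (h (i + l * c) - h (i + l * c + c)) ^ 2 := by
    intro i
    have h2 : h i - h (i + k * c) = ∑ l ∈ range k, (h (i + l * c) - h (i + l * c + c)) := by
      have := sum_range_sub' (fun l : ℕ => h (i + l * c)) k
      simp only [Nat.cast_zero, zero_mul, add_zero, Nat.cast_add, Nat.cast_one] at this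
      rw [← this]
      refine sum_congr rfl fun l _ => ?_
      rw [add_mul, one_mul, add_assoc]
    rw [h2]
    simpa using sq_sum_le_card_mul_sum_sq (s := range k)
      (f := fun l : ℕ => h (i + l * c) - h (i + l * c + c))
  calc transDist h (k * c)
      ≤ ∑ i, k * ∑ l ∈ range k, (h (i + l * c) - h (i + l * c + c)) ^ 2 := sum_le_sum fun i _ => h1 i
    _ = k * ∑ l ∈ range k, transDist h c := by
        rw [← mul_sum, sum_comm]
        congr 1
        refine sum_congr rfl fun l _ => ?_
        exact Equiv.sum_comp (Equiv.addRight ((l : ZMod p) * c)) fun i => (h i - h (i + c)) ^ 2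
    _ = _ := by
        rw [sum_const, card_range, nsmul_eq_mul]
        ring

theorem sum_transDist (h : ZMod p → ℝ) :
    ∑ c, transDist h c = 2 * (p * ∑ i, h i ^ 2) - 2 * (∑ i, h i) ^ 2 := by
  have h1 : ∀ i, ∑ c, (h i - h (i + c)) ^ 2
      = p * h i ^ 2 - 2 * (h i * ∑ j, h j) + ∑ j, h j ^ 2 := by
    intro i
    rw [show ∑ c, (h i - h (i + c)) ^ 2 = ∑ j, (h i - h j) ^ 2 from
      Equiv.sum_comp (Equiv.addLeft i) fun j => (h i - h j) ^ 2]
    simp only [sub_sq, sum_add_distrib, sum_sub_distrib, sum_const, card_univ, ZMod.card,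
      nsmul_eq_mul, mul_assoc, ← mul_sum]
  simp only [transDist]
  rw [sum_comm]
  simp only [h1, sum_add_distrib, sum_sub_distrib, ← mul_sum, ← sum_mul, sum_const, card_univ,
    ZMod.card, nsmul_eq_mul]
  ring

/-- The variance `1 - (∑ √q)² / p` of the unit vector `√q`. -/
def sqrtVar (q : ZMod p → ℝ) : ℝ := 1 - (∑ j, √(q j)) ^ 2 / p

/-- As `p` is prime, every translation is a multiple of `c` by fewer than `p` steps, at a cost of at
most `p²`. Averaging `transDist` over all translations gives `2 * sqrtVar q`. -/
theorem two_mul_sqrtVar_le [Fact p.Prime] {q : ZMod p → ℝ} (hq : ∀ j, 0 ≤ q j)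
    (hq1 : ∑ j, q j = 1) {c : ZMod p} (hc : c ≠ 0) :
    2 * sqrtVar q ≤ (p : ℝ) ^ 2 * transDist (fun i => √(q i)) c := by
  have hp : (0 : ℝ) < p := by exact_mod_cast Nat.pos_of_ne_zero (NeZero.ne p)
  have h1 : ∀ b, transDist (fun i => √(q i)) b ≤ (p : ℝ) ^ 2 * transDist (fun i => √(q i)) c := by
    intro b
    have hb : (((b / c).val : ℕ) : ZMod p) * c = b := by
      rw [ZMod.natCast_zmod_val, div_mul_cancel₀ _ hc]
    have h2 := transDist_nsmul_le (fun i => √(q i)) c (b / c).val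
    rw [hb] at h2
    refine h2.trans ?_
    have h3 : ((b / c).val : ℝ) ≤ p := by exact_mod_cast (ZMod.val_lt _).le
    have h4 : 0 ≤ transDist (fun i => √(q i)) c := sum_nonneg fun _ _ => sq_nonneg _
    gcongr
  have h2 := sum_le_sum fun b (_ : b ∈ univ) => h1 b
  rw [sum_transDist] at h2
  simp only [Real.sq_sqrt (hq _), hq1, sum_const, card_univ, ZMod.card, nsmul_eq_mul] at h2
  refine le_of_mul_le_mul_left ?_ hp
  rw [sqrtVar]
  calc _ = 2 * (p * 1) - 2 * (∑ i, √(q i)) ^ 2 := by field_simp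
    _ ≤ _ := h2

theorem sqrtVar_nonneg {q : ZMod p → ℝ} (hq : ∀ j, 0 ≤ q j) (hq1 : ∑ j, q j = 1) :
    0 ≤ sqrtVar q := by
  have hp : (0 : ℝ) < p := by exact_mod_cast Nat.pos_of_ne_zero (NeZero.ne p)
  have := sq_sum_le_card_mul_sum_sq (s := univ) (f := fun j => √(q j))
  simp only [Real.sq_sqrt (hq _), hq1, card_univ, ZMod.card, mul_one] at this
  rw [sqrtVar, sub_nonneg, div_le_one hp]
  exact this

/-- Averaging over a reflection centre that does not concentrate on one point. -/
theorem sqrtVar_div_le_sum [Fact p.Prime] {q : ZMod p → ℝ} (hq : ∀ j, 0 ≤ q j)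
    (hq1 : ∑ j, q j = 1) (hmax : ∀ j, q j ≤ 15 / 16) (s : ZMod p) :
    sqrtVar q / (32 * (p : ℝ) ^ 2) ≤ ∑ a, q a * reflDist q (-(a + s)) := by
  have hp : (0 : ℝ) < p := by exact_mod_cast Nat.pos_of_ne_zero (NeZero.ne p)
  set V := sqrtVar q
  have hV : 0 ≤ V := sqrtVar_nonneg hq hq1
  set R : ZMod p → ℝ := fun a => reflDist q (-(a + s)) with hR
  have hR0 : ∀ a, 0 ≤ R a := fun a => reflDist_nonneg _ _
  -- Near-symmetry about two distinct centres would force near-invariance under a translation. Two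
  -- independent draws from `q` differ with probability at least 1/16.
  have h1 : ∀ a b, (if a = b then 0 else V / (p : ℝ) ^ 2) ≤ R a + R b := by
    intro a b
    split_ifs with hab
    · exact add_nonneg (hR0 a) (hR0 b)
    · have h2 := two_mul_sqrtVar_le hq hq1 (c := -(b + s) - -(a + s)) (by
        rw [show -(b + s) - -(a + s) = a - b by ring]
        exact sub_ne_zero.2 hab)
      have h3 := transDist_sub_le q (-(a + s)) (-(b + s))
      rw [div_le_iff₀ (by positivity)]
      have h4 : (0 : ℝ) < (p : ℝ) ^ 2 := by positivity
      simp only [hR]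
      nlinarith
  have h2 : ∑ a, ∑ b, q a * q b * (if a = b then 0 else V / (p : ℝ) ^ 2)
      ≤ ∑ a, ∑ b, q a * q b * (R a + R b) :=
    sum_le_sum fun a _ => sum_le_sum fun b _ =>
      mul_le_mul_of_nonneg_left (h1 a b) (mul_nonneg (hq a) (hq b))
  have h3 : ∑ a, ∑ b, q a * q b * (R a + R b) = 2 * ∑ a, q a * R a := by
    have e1 : ∀ a, ∑ b, q a * q b * (R a + R b) = q a * R a + q a * ∑ b, q b * R b := by
      intro a
      calc _ = ∑ b, (q a * R a * q b + q a * (q b * R b)) := sum_congr rfl fun b _ => by ring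
        _ = _ := by rw [sum_add_distrib, ← mul_sum, ← mul_sum, hq1, mul_one]
    simp only [e1, sum_add_distrib, ← sum_mul, hq1]
    ring
  have h4 : ∑ a, ∑ b, q a * q b * (if a = b then 0 else V / (p : ℝ) ^ 2)
      = (∑ a, q a * (1 - q a)) * (V / (p : ℝ) ^ 2) := by
    rw [sum_mul]
    refine sum_congr rfl fun a _ => ?_
    have e1 : ∀ b, q a * q b * (if a = b then 0 else V / (p : ℝ) ^ 2)
        = q a * (V / (p : ℝ) ^ 2) * (q b - if a = b then q b else 0) := by
      intro b
      split_ifs <;> ring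
    simp only [e1, ← mul_sum, sum_sub_distrib, hq1, sum_ite_eq, mem_univ, if_true]
    ring
  have h5 : 1 / 16 ≤ ∑ a, q a * (1 - q a) := by
    calc (1 / 16 : ℝ) = ∑ a, q a * (1 / 16) := by rw [← sum_mul, hq1, one_mul]
      _ ≤ _ := sum_le_sum fun a _ =>
        mul_le_mul_of_nonneg_left (by linarith [hmax a]) (hq a)
  have h6 : 1 / 16 * (V / (p : ℝ) ^ 2) ≤ 2 * ∑ a, q a * R a := by
    rw [← h3]
    refine le_trans ?_ h2
    rw [h4]
    exact mul_le_mul_of_nonneg_right h5 (by positivity)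
  calc V / (32 * (p : ℝ) ^ 2) = 1 / 32 * (V / (p : ℝ) ^ 2) := by
        field_simp
    _ ≤ _ := by linarith

/-- Averaging over a reflection centre that is close to uniform. -/
theorem sqrtVar_le_sum {q : ZMod p → ℝ} (hq : ∀ j, 0 ≤ q j) (hq1 : ∑ j, q j = 1)
    (hu : ∑ j, |q j - 1 / p| ≤ 1 / 2) (s : ZMod p) :
    sqrtVar q ≤ ∑ a, q a * reflDist q (-(a + s)) := by
  have hp : (0 : ℝ) < p := by exact_mod_cast Nat.pos_of_ne_zero (NeZero.ne p)
  set V := sqrtVar q with hVdef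
  set μ : ℝ := (∑ j, √(q j)) / p with hμ
  set g : ZMod p → ℝ := fun j => √(q j) - μ with hg
  have hμp : ∑ j, √(q j) = p * μ := by rw [hμ]; field_simp
  have hgs : ∑ j, g j = 0 := by
    simp [hg, sum_sub_distrib, hμp]
  have hgV : ∑ j, g j ^ 2 = V := by
    simp only [hg, sub_sq, sum_add_distrib, sum_sub_distrib, Real.sq_sqrt (hq _), hq1, sum_const,
      card_univ, ZMod.card, nsmul_eq_mul, ← sum_mul, ← mul_sum, hμp, hVdef, sqrtVar]
    field_simp
    ring
  -- `B` is the reflected correlation of the centred `√q`. It sums to zero over all centres, so only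
  -- the deviation of `q` from uniform contributes to its average.
  set B : ZMod p → ℝ := fun t => ∑ i, g i * g (t - i) with hB
  have hrefl : ∀ t, ∑ i, g (t - i) ^ 2 = V := fun t => by
    rw [← hgV]
    exact (Equiv.subLeft t).sum_comp fun i => g i ^ 2
  have hR : ∀ t, reflDist q t = 2 * V - 2 * B t := by
    intro t
    have : ∀ i, (√(q i) - √(q (t - i))) ^ 2
        = g i ^ 2 + g (t - i) ^ 2 - 2 * (g i * g (t - i)) := fun i => by simp only [hg]; ring
    simp only [reflDist, this, sum_add_distrib, sum_sub_distrib, ← mul_sum, hgV, hrefl, hB]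
    ring
  have hBabs : ∀ t, |B t| ≤ V := by
    intro t
    refine (abs_sum_le_sum_abs _ _).trans ?_
    have h1 : ∀ i, |g i * g (t - i)| ≤ (g i ^ 2 + g (t - i) ^ 2) / 2 := fun i => by
      rw [abs_le]
      constructor <;> nlinarith [sq_nonneg (g i + g (t - i)), sq_nonneg (g i - g (t - i))]
    refine (sum_le_sum fun i _ => h1 i).trans ?_
    rw [← sum_div, sum_add_distrib, hgV, hrefl]
    linarith
  have hBsum : ∑ a, B (-(a + s)) = 0 := by
    have e1 : ∑ a, B (-(a + s)) = ∑ t, B t :=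
      ((Equiv.addRight s).trans (Equiv.neg _)).sum_comp B
    rw [e1, sum_comm]
    refine sum_eq_zero fun i _ => ?_
    rw [← mul_sum, ← mul_zero (g i), ← hgs]
    exact congrArg (g i * ·) (Equiv.sum_comp (Equiv.subRight i) g)
  have hV : 0 ≤ V := sqrtVar_nonneg hq hq1
  have h1 : ∑ a, q a * B (-(a + s)) ≤ 1 / 2 * V := by
    calc ∑ a, q a * B (-(a + s)) = ∑ a, (q a - 1 / p) * B (-(a + s)) := by
          simp only [sub_mul, sum_sub_distrib, ← mul_sum, hBsum, mul_zero, sub_zero]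
      _ ≤ ∑ a, |q a - 1 / p| * V := sum_le_sum fun a _ => by
          refine (le_abs_self _).trans ?_
          rw [abs_mul]
          exact mul_le_mul_of_nonneg_left (hBabs _) (abs_nonneg _)
      _ ≤ _ := by
          rw [← sum_mul]
          exact mul_le_mul_of_nonneg_right hu hV
  have h2 : ∑ a, q a * reflDist q (-(a + s)) = 2 * V - 2 * ∑ a, q a * B (-(a + s)) := by
    simp only [hR, mul_sub, sum_sub_distrib, ← sum_mul, hq1, mul_sum]
    rw [one_mul]
    congr 1
    exact sum_congr rfl fun a _ => by ring
  linarith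

/-- Let `H` be the squared Hellinger distance from `q` to uniform. If `H > 1/16`, the translation
argument applies and its loss of `p²` is affordable. Otherwise `q` is within 1/2 of uniform in `ℓ¹`,
and `H / 2` bounds the average without loss; if moreover `H < 1/p`, then `√(q j) ≤ 2/√p`, so `H`
controls the `ℓ²` distance. -/
theorem min_le_sum_mul_reflDist [Fact p.Prime] {q : ZMod p → ℝ} (hq : ∀ j, 0 ≤ q j)
    (hq1 : ∑ j, q j = 1) (hmax : ∀ j, q j ≤ 15 / 16) (s : ZMod p) :
    1 / 1024 * min (1 / (p : ℝ) ^ 2) ((p : ℝ) * ∑ j, (q j - 1 / p) ^ 2)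
      ≤ ∑ a, q a * reflDist q (-(a + s)) := by
  have hp1 : (1 : ℝ) ≤ p := by exact_mod_cast Nat.one_le_iff_ne_zero.2 (NeZero.ne p)
  have hp : (0 : ℝ) < p := by linarith
  set E := ∑ a, q a * reflDist q (-(a + s))
  set u : ℝ := 1 / √p with hu
  have hu0 : 0 < u := by positivity
  have hu2 : u ^ 2 = 1 / p := by rw [hu, div_pow, Real.sq_sqrt hp.le, one_pow]
  set α : ℝ := (∑ j, √(q j)) * u with hα
  have hV : sqrtVar q = 1 - α ^ 2 := by
    rw [sqrtVar, hα, mul_pow, hu2]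
    ring
  have hV0 : 0 ≤ sqrtVar q := sqrtVar_nonneg hq hq1
  have hα0 : 0 ≤ α := mul_nonneg (sum_nonneg fun _ _ => Real.sqrt_nonneg _) hu0.le
  have hα1 : α ≤ 1 := by nlinarith
  set H := ∑ j, (√(q j) - u) ^ 2 with hHdef
  have hH : H = 2 - 2 * α := by
    simp only [hHdef, sub_sq, sum_add_distrib, sum_sub_distrib, Real.sq_sqrt (hq _), hq1, sum_const,
      card_univ, ZMod.card, nsmul_eq_mul, ← sum_mul, ← mul_sum, hu2, hα]
    field_simp
    ring
  have hH' : ∑ j, (√(q j) + u) ^ 2 = 2 + 2 * α := by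
    simp only [add_sq, sum_add_distrib, Real.sq_sqrt (hq _), hq1, sum_const,
      card_univ, ZMod.card, nsmul_eq_mul, ← sum_mul, ← mul_sum, hu2, hα]
    field_simp
    ring
  have hVH : H / 2 ≤ sqrtVar q := by rw [hV, hH]; nlinarith
  have hfac : ∀ j, q j - 1 / p = (√(q j) - u) * (√(q j) + u) := fun j => by
    nlinarith [Real.sq_sqrt (hq j)]
  have hleft : min (1 / (p : ℝ) ^ 2) ((p : ℝ) * ∑ j, (q j - 1 / p) ^ 2) ≤ 1 / (p : ℝ) ^ 2 := min_le_left _ _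
  have hright : min (1 / (p : ℝ) ^ 2) ((p : ℝ) * ∑ j, (q j - 1 / p) ^ 2)
      ≤ p * ∑ j, (q j - 1 / p) ^ 2 := min_le_right _ _
  by_cases hbig : 1 / 16 < H
  · have h1 := sqrtVar_div_le_sum hq hq1 hmax s
    refine le_trans ?_ h1
    calc _ ≤ 1 / 1024 * (1 / (p : ℝ) ^ 2) := by linarith
      _ = (1 / 32) / (32 * (p : ℝ) ^ 2) := by field_simp; norm_num
      _ ≤ _ := by
        gcongr
        linarith
  · rw [not_lt] at hbig
    have hl1 : ∑ j, |q j - 1 / p| ≤ 1 / 2 := by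
      have hcs := sum_mul_sq_le_sq_mul_sq univ (fun j => |√(q j) - u|) fun j => |√(q j) + u|
      simp only [sq_abs, ← abs_mul, ← hfac] at hcs
      rw [← hHdef, hH'] at hcs
      refine abs_le_of_sq_le_sq' ?_ (by norm_num) |>.2
      nlinarith
    have h1 := sqrtVar_le_sum hq hq1 hl1 s
    have h2 : H / 2 ≤ E := hVH.trans h1
    by_cases hm : 1 / p ≤ H
    · have h3 : 1 / (p : ℝ) ^ 2 ≤ 1 / p := by
        apply one_div_le_one_div_of_le hp
        nlinarith
      have h4 : 0 < 1 / (p : ℝ) ^ 2 := by positivity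
      linarith
    · rw [not_le] at hm
      have h3 : ∀ j, √(q j) ≤ 2 * u := fun j => by
        have h4 : (√(q j) - u) ^ 2 ≤ H :=
          single_le_sum (f := fun j => (√(q j) - u) ^ 2) (fun _ _ => sq_nonneg _) (mem_univ j)
        have := abs_le_of_sq_le_sq (a := √(q j) - u) (b := u) (by linarith) hu0.le
        linarith [le_abs_self (√(q j) - u)]
      have h4 : ∑ j, (q j - 1 / p) ^ 2 ≤ 9 / p * H := by
        rw [hHdef, mul_sum]
        refine sum_le_sum fun j _ => ?_
        rw [hfac, mul_pow, mul_comm, show (9 : ℝ) / p = (3 * u) ^ 2 by rw [mul_pow, hu2]; ring]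
        have := Real.sqrt_nonneg (q j)
        gcongr
        linarith [h3 j]
      have h5 : p * ∑ j, (q j - 1 / p) ^ 2 ≤ 9 * H := by
        calc _ ≤ p * (9 / p * H) := by gcongr
          _ = _ := by field_simp
      have h6 : 0 ≤ H := sum_nonneg fun _ _ => sq_nonneg _
      linarith

/-- The remainder in Young's inequality is bounded below in terms of the distance of `q` from the
point mass at zero and from the uniform distribution. -/
theorem min_le_sum_prod_mul_reflDist [Fact p.Prime] {e : ℕ} (hpd : ¬ p ∣ e + 3) {q : ZMod p → ℝ}
    (hq : ∀ j, 0 ≤ q j) (hq1 : ∑ j, q j = 1) :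
    (1 / 2) ^ e / 1024 * min (1 - q 0) (min (1 / (p : ℝ) ^ 2) ((p : ℝ) * ∑ j, (q j - 1 / p) ^ 2))
      ≤ ∑ v : Fin (e + 1) → ZMod p, (∏ l, q (v l)) * reflDist q (-∑ l, v l) := by
  have hp1 : (1 : ℝ) ≤ p := by exact_mod_cast Nat.one_le_iff_ne_zero.2 (NeZero.ne p)
  have hterm : ∀ v : Fin (e + 1) → ZMod p, 0 ≤ (∏ l, q (v l)) * reflDist q (-∑ l, v l) :=
    fun v => mul_nonneg (prod_nonneg fun _ _ => hq _) (reflDist_nonneg _ _)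
  have hle1 : ∀ j, q j ≤ 1 := fun j => by
    rw [← hq1]
    exact single_le_sum (f := q) (fun _ _ => hq _) (mem_univ j)
  have hS : 0 ≤ ∑ j, (q j - 1 / p) ^ 2 := sum_nonneg fun _ _ => sq_nonneg _
  set M := min (1 / (p : ℝ) ^ 2) ((p : ℝ) * ∑ j, (q j - 1 / p) ^ 2) with hM
  have hM0 : 0 ≤ M := le_min (by positivity) (by positivity)
  have hM1 : M ≤ 1 := (min_le_left _ _).trans (by
    rw [div_le_one (by positivity)]
    nlinarith)
  have hhalf : (0 : ℝ) < (1 / 2) ^ e := by positivity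
  have hhalf1 : ((1 : ℝ) / 2) ^ e ≤ 1 := pow_le_one₀ (by norm_num) (by norm_num)
  by_cases hmax : ∀ j, q j ≤ 15 / 16
  -- No dominant letter: averaging over the first letter suffices, whatever the others are.
  · rw [sum_fin_succ_fun, sum_comm]
    calc _ ≤ 1 / 1024 * M := by
          have : min (1 - q 0) M ≤ M := min_le_right _ _
          have h0 : 0 ≤ min (1 - q 0) M := le_min (by linarith [hle1 0]) hM0
          nlinarith
      _ = ∑ v : Fin e → ZMod p, (∏ l, q (v l)) * (1 / 1024 * M) := by
          rw [← sum_mul, sum_prod_word hq1, one_mul]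
      _ ≤ _ := by
          refine sum_le_sum fun v _ => ?_
          have h1 := min_le_sum_mul_reflDist hq hq1 hmax (∑ l, v l)
          calc _ ≤ (∏ l, q (v l)) * ∑ a, q a * reflDist q (-(a + ∑ l, v l)) :=
                mul_le_mul_of_nonneg_left h1 (prod_nonneg fun _ _ => hq _)
            _ = _ := by
                rw [mul_sum]
                refine sum_congr rfl fun a _ => ?_
                simp only [Fin.prod_univ_succ, Fin.sum_univ_succ, Fin.cons_zero, Fin.cons_succ]
                ring
  · push Not at hmax
    obtain ⟨k, hk⟩ := hmax
    have hkp : ((1 : ℝ) / 2) ^ e ≤ q k ^ e := pow_le_pow_left₀ (by norm_num) (by linarith) _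
    by_cases hk0 : k = 0
    · subst hk0
      -- Mass concentrated at 0: only the words `(a, 0, …, 0)` with `a ≠ 0` are kept, since
      -- reflection about `-a` moves the dominant letter 0.
      have h1 : ∀ a : ZMod p, (if a = 0 then 0 else q a * ((1 / 2) ^ e * (1 / 4)))
          ≤ (∏ l, q ((Fin.cons a 0 : Fin (e + 1) → ZMod p) l)) *
            reflDist q (-∑ l, (Fin.cons a 0 : Fin (e + 1) → ZMod p) l) := by
        intro a
        split_ifs with ha
        · exact hterm _
        · simp only [Fin.prod_univ_succ, Fin.sum_univ_succ, Fin.cons_zero, Fin.cons_succ,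
            Pi.zero_apply, prod_const, card_univ, Fintype.card_fin, sum_const_zero, add_zero,
            mul_assoc]
          have h2 := quarter_le_reflDist hq hq1 hk (t := -a) (by simpa using ha)
          have := hq a
          gcongr
      rw [sum_fin_succ_fun]
      have h2 : ∑ a : ZMod p, (if a = 0 then 0 else q a * ((1 / 2) ^ e * (1 / 4)))
          = (1 - q 0) * ((1 / 2) ^ e * (1 / 4)) := by
        have e1 : ∀ a : ZMod p, (if a = 0 then 0 else q a * (((1 : ℝ) / 2) ^ e * (1 / 4)))
            = (q a - if a = 0 then q a else 0) * ((1 / 2) ^ e * (1 / 4)) := fun a => by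
          split_ifs <;> ring
        simp only [e1, ← sum_mul, sum_sub_distrib, hq1, sum_ite_eq', mem_univ, if_true]
      calc _ ≤ (1 - q 0) * ((1 / 2) ^ e * (1 / 4)) := by
            have : min (1 - q 0) M ≤ 1 - q 0 := min_le_left _ _
            have h0 : 0 ≤ 1 - q 0 := by linarith [hle1 0]
            nlinarith
        _ ≤ _ := by
            rw [← h2]
            refine sum_le_sum fun a _ => (h1 a).trans ?_
            exact single_le_sum (f := fun v : Fin e → ZMod p =>
              (∏ l, q ((Fin.cons a v : Fin (e + 1) → ZMod p) l)) *
                reflDist q (-∑ l, (Fin.cons a v : Fin (e + 1) → ZMod p) l))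
              (fun _ _ => hterm _) (mem_univ 0)
    -- Mass concentrated at `k ≠ 0`: the constant word `k` suffices. Its reflection fixes `k` only
    -- if `(e + 3) k = 0`, which `p ∤ d` excludes.
    · have h1 := quarter_le_reflDist hq hq1 hk (t := -∑ _l : Fin (e + 1), k) (by
        intro h
        simp only [sum_const, card_univ, Fintype.card_fin, nsmul_eq_mul] at h
        have h2 : ((e + 3 : ℕ) : ZMod p) * k = 0 := by
          push_cast at h ⊢
          linear_combination -h
        rcases mul_eq_zero.1 h2 with h3 | h3
        · exact hpd ((ZMod.natCast_eq_zero_iff _ _).1 h3)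
        · exact hk0 h3)
      have h2 := single_le_sum (f := fun v : Fin (e + 1) → ZMod p =>
        (∏ l, q (v l)) * reflDist q (-∑ l, v l)) (fun v _ => hterm v) (mem_univ fun _ => k)
      refine le_trans ?_ h2
      have h3 : ((1 : ℝ) / 2) ^ e * (1 / 2) ≤ ∏ _l : Fin (e + 1), q k := by
        rw [prod_const, card_univ, Fintype.card_fin, pow_succ]
        exact mul_le_mul hkp (by linarith) (by norm_num) (hhalf.le.trans hkp)
      have h4 : min (1 - q 0) M ≤ 1 := (min_le_right _ _).trans hM1
      calc _ ≤ ((1 : ℝ) / 2) ^ e * (1 / 2) * (1 / 4) := by nlinarith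
        _ ≤ _ := mul_le_mul h3 h1 (by norm_num) ((by positivity : (0 : ℝ) ≤ _).trans h3)

/-! ### Exponential bound from Young's inequality. -/

theorem contribution_nonneg (d n : ℕ) (N : ZMod p → ℕ) : 0 ≤ contribution d p n N := by
  rw [contribution, walkProb]
  have : 0 ≤ ∏ j, ((d * N j).factorial : ℝ) := prod_nonneg fun _ _ => Nat.cast_nonneg _
  positivity

/-- The constant in the stability estimate for Young's inequality. -/
def youngConst (d : ℕ) : ℝ := (1 / 2) ^ (d - 3) / 1024 / d

theorem youngConst_pos {d : ℕ} (hd : 3 ≤ d) : 0 < youngConst d := by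
  have : (0 : ℝ) < d := by exact_mod_cast (by omega : 0 < d)
  rw [youngConst]
  positivity

theorem zeroSumPoly_le_exp [Fact p.Prime] {d : ℕ} (hd : 3 ≤ d) (hpd : ¬ p ∣ d) {q : ZMod p → ℝ}
    (hq : ∀ j, 0 ≤ q j) (hq1 : ∑ j, q j = 1) :
    zeroSumPoly d p (fun j => (q j ^ (d : ℝ)⁻¹) ^ (d - 1))
      ≤ Real.exp (-(youngConst d *
        min (1 - q 0) (min (1 / (p : ℝ) ^ 2) ((p : ℝ) * ∑ j, (q j - 1 / p) ^ 2)))) := by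
  obtain ⟨e, rfl⟩ : ∃ e, d = e + 3 := ⟨d - 3, by omega⟩
  have h1 := zeroSumPoly_le_one_sub (e + 1) hq hq1
  have h2 := min_le_sum_prod_mul_reflDist hpd hq hq1
  have hd0 : (0 : ℝ) < (e + 3 : ℕ) := by positivity
  have h3 := h1.trans (sub_le_sub_left h2 _)
  refine le_trans ?_ (Real.one_sub_le_exp_neg _)
  rw [youngConst]
  simp only [Nat.add_sub_cancel]
  refine le_of_mul_le_mul_left (h3.trans (le_of_eq ?_)) hd0
  field_simp

/-- The weight `x = q ^ ((d-1)/d)` makes `∏ x j ^ (d N j)` equal to the entropy term. -/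
theorem contribution_le_exp [Fact p.Prime] {d n : ℕ} (hd : 3 ≤ d) (hpd : ¬ p ∣ d) (hn : n ≠ 0)
    {N : ZMod p → ℕ} (hN : ∑ j, N j = n) :
    contribution d p n N ≤ √d ^ p * Real.exp (-(n * (youngConst d *
      min (1 - (N 0 : ℝ) / n)
        (min (1 / (p : ℝ) ^ 2) ((p : ℝ) * ∑ j, ((N j : ℝ) / n - 1 / p) ^ 2))))) := by
  have hn' : (0 : ℝ) < n := by exact_mod_cast Nat.pos_of_ne_zero hn
  have hd1 : (1 : ℝ) ≤ d := by exact_mod_cast (by omega : 1 ≤ d)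
  set q : ZMod p → ℝ := fun j => (N j : ℝ) / n with hqdef
  have hq : ∀ j, 0 ≤ q j := fun j => by positivity
  have hq1 : ∑ j, q j = 1 := by
    rw [hqdef, ← sum_div, ← Nat.cast_sum, hN, div_self hn'.ne']
  set x : ZMod p → ℝ := fun j => (q j ^ (d : ℝ)⁻¹) ^ (d - 1) with hxdef
  have hx : ∀ j, 0 ≤ x j := fun j => pow_nonneg (Real.rpow_nonneg (hq j) _) _
  have h1 := contribution_mul_le hd hn hN hx
  have h2 : ∏ j, x j ^ (d * N j) = ∏ j, ((N j : ℝ) / n) ^ ((d - 1) * N j) := by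
    refine prod_congr rfl fun j _ => ?_
    rw [hxdef]
    simp only [← pow_mul]
    rw [show (d - 1) * (d * N j) = d * ((d - 1) * N j) by ring, pow_mul,
      Real.rpow_inv_natCast_pow (hq j) (by omega)]
  have h3 : 0 < ∏ j, ((N j : ℝ) / n) ^ ((d - 1) * N j) := by
    refine prod_pos fun j _ => ?_
    rcases Nat.eq_zero_or_pos (N j) with h | h
    · simp [h]
    · have : (0 : ℝ) < N j := by exact_mod_cast h
      positivity
  rw [h2] at h1
  have h4 : contribution d p n N ≤ √d ^ #{j | N j ≠ 0} * zeroSumPoly d p x ^ n := by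
    refine le_of_mul_le_mul_right (h1.trans (le_of_eq ?_)) h3
    ring
  refine h4.trans (mul_le_mul ?_ ?_ (pow_nonneg (zeroSumPoly_nonneg hx) _) (by positivity))
  · refine pow_le_pow_right₀ (Real.one_le_sqrt.2 hd1) ?_
    simpa using card_le_univ (filter (fun j => N j ≠ 0) univ)
  · rw [← mul_neg, Real.exp_nat_mul]
    exact pow_le_pow_left₀ (zeroSumPoly_nonneg hx) (zeroSumPoly_le_exp hd hpd hq hq1) _

/-! ### Contributions near the point mass at zero. -/

/-- The sum of `∏ x (v l)` over all words `v` of length `k` whose letters sum to `t`. -/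
def wordSum (x : ZMod p → ℝ) (k : ℕ) (t : ZMod p) : ℝ :=
  ∑ v : Fin k → ZMod p, if ∑ l, v l = t then ∏ l, x (v l) else 0

theorem wordSum_succ (x : ZMod p → ℝ) (k : ℕ) (t : ZMod p) :
    wordSum x (k + 1) t = ∑ a, x a * wordSum x k (t - a) := by
  rw [wordSum, sum_fin_succ_fun]
  refine sum_congr rfl fun a _ => ?_
  rw [wordSum, mul_sum]
  refine sum_congr rfl fun v _ => ?_
  simp only [Fin.prod_univ_succ, Fin.sum_univ_succ, Fin.cons_zero, Fin.cons_succ, mul_ite, mul_zero,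
    eq_sub_iff_add_eq, add_comm a]

theorem zeroSumPoly_eq_wordSum (x : ZMod p → ℝ) (d : ℕ) :
    zeroSumPoly d p x = wordSum x d 0 := by
  rw [zeroSumPoly, wordSum, sum_filter]

/-- Two nonzero letters with prescribed sum weigh at most `s`, by Cauchy-Schwarz. In the application
`y 0 = 0`, so at `t = 0` the linear term vanishes and the excess over 1 is only of order `s`. -/
theorem wordSum_le {y : ZMod p → ℝ} (hy : ∀ j, 0 ≤ y j) {s : ℝ} (hs : ∑ j, y j ^ 2 ≤ s)
    (hy1 : ∑ j, y j ≤ 1) (k : ℕ) (t : ZMod p) :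
    wordSum (fun j => (if j = 0 then 1 else 0) + y j) k t
      ≤ (if t = 0 then 1 else 0) + 3 ^ k * (y t + s) := by
  have hs0 : 0 ≤ s := (sum_nonneg fun _ _ => sq_nonneg _).trans hs
  induction k generalizing t with
  | zero =>
    have := hy t
    simp only [wordSum, univ_unique, univ_eq_empty, sum_empty, prod_empty, sum_const, card_singleton,
      one_smul, pow_zero, one_mul, eq_comm (a := (0 : ZMod p))]
    linarith
  | succ k ih =>
    rw [wordSum_succ]
    have h1 : ∑ a, y a * y (t - a) ≤ s := by
      have h2 : ∀ a, y a * y (t - a) ≤ (y a ^ 2 + y (t - a) ^ 2) / 2 := fun a => by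
        nlinarith [sq_nonneg (y a - y (t - a))]
      have h3 : ∑ a, y (t - a) ^ 2 = ∑ a, y a ^ 2 := Equiv.sum_comp (Equiv.subLeft t) fun a => y a ^ 2
      refine (sum_le_sum fun a _ => h2 a).trans ?_
      rw [← sum_div, sum_add_distrib, h3]
      linarith
    have h3k : (1 : ℝ) ≤ 3 ^ k := one_le_pow₀ (by norm_num)
    have hyt := hy t
    calc _ ≤ ∑ a, ((if a = 0 then 1 else 0) + y a) *
          ((if t - a = 0 then 1 else 0) + 3 ^ k * (y (t - a) + s)) := by
          refine sum_le_sum fun a _ => mul_le_mul_of_nonneg_left (ih _) ?_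
          have := hy a
          split_ifs <;> linarith
      _ = (if t = 0 then 1 else 0) + 3 ^ k * (y t + s) + (y t +
            3 ^ k * (∑ a, y a * y (t - a) + s * ∑ a, y a)) := by
          have e1 : ∀ a, ((if a = 0 then (1 : ℝ) else 0) + y a) *
              ((if t - a = 0 then 1 else 0) + 3 ^ k * (y (t - a) + s))
              = (if a = 0 then ((if t - a = 0 then 1 else 0) + 3 ^ k * (y (t - a) + s)) else 0) +
                ((if t = a then y a else 0) + 3 ^ k * (y a * y (t - a) + s * y a)) := by
            intro a
            simp only [sub_eq_zero]
            split_ifs <;> ring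
          simp only [e1, sum_add_distrib, sum_ite_eq', sum_ite_eq, mem_univ, if_true, sub_zero,
            ← mul_sum]
      _ ≤ _ := by
          have h4 : s * ∑ a, y a ≤ s := mul_le_of_le_one_right hs0 hy1
          have h5 : 3 ^ k * (∑ a, y a * y (t - a) + s * ∑ a, y a) ≤ 3 ^ k * (s + s) := by gcongr
          have h6 : y t ≤ 3 ^ k * y t := le_mul_of_one_le_left hyt h3k
          have h7 : (0 : ℝ) ≤ 3 ^ k * s := by positivity
          rw [pow_succ]
          linarith

/-- With `x 0 = 1` and `x j = √(N j / n)`, put `Q = ∏ x j ^ N j`. The entropy term is at most `Q ^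
(2(d-1))`, so dividing by `Q ^ d` leaves `Q ^ (d-2)`, a genuine gain because `d ≥ 3`. The condition
`p m ≤ n` ensures that the weights off zero sum to at most 1. -/
theorem contribution_le_pow {d n m : ℕ} (hd : 3 ≤ d) (hm : m ≠ 0)
    {N : ZMod p → ℕ} (hN : ∑ j, N j = n) (hNm : N 0 + m = n) (hpm : p * m ≤ n) :
    contribution d p n N ≤ (d * Real.exp (3 ^ d) * √(m / n)) ^ m := by
  have hn : n ≠ 0 := by omega
  have hn' : (0 : ℝ) < n := by exact_mod_cast Nat.pos_of_ne_zero hn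
  have hd1 : (1 : ℝ) ≤ d := by exact_mod_cast (by omega : 1 ≤ d)
  have hmsum : ∑ j ∈ univ.erase (0 : ZMod p), N j = m := by
    have := add_sum_erase univ N (mem_univ 0)
    omega
  have hmn : (m : ℝ) / n ≤ 1 := by
    rw [div_le_one hn']
    exact_mod_cast (by omega : m ≤ n)
  set s : ℝ := m / n with hs
  set y : ZMod p → ℝ := fun j => if j = 0 then 0 else √(N j / n) with hydef
  have hy : ∀ j, 0 ≤ y j := fun j => by simp only [hydef]; positivity
  have hys : ∑ j, y j ^ 2 = s := by
    rw [← add_sum_erase univ _ (mem_univ 0), hs, ← hmsum, Nat.cast_sum, sum_div]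
    simp only [hydef, if_true, ne_eq, OfNat.ofNat_ne_zero, not_false_eq_true, zero_pow, zero_add]
    refine sum_congr rfl fun j hj => ?_
    rw [if_neg (ne_of_mem_erase hj), Real.sq_sqrt (by positivity)]
  have hy1 : ∑ j, y j ≤ 1 := by
    have h1 := sq_sum_le_card_mul_sum_sq (s := univ) (f := y)
    rw [hys, card_univ, ZMod.card] at h1
    have h2 : (p : ℝ) * s ≤ 1 := by
      rw [hs, mul_div_assoc', div_le_one hn']
      exact_mod_cast hpm
    nlinarith [sum_nonneg fun j (_ : j ∈ univ) => hy j]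
  set x : ZMod p → ℝ := fun j => (if j = 0 then 1 else 0) + y j with hxdef
  have hx : ∀ j, 0 ≤ x j := fun j => add_nonneg (by positivity) (hy j)
  have hx0 : x 0 = 1 := by simp [hxdef, hydef]
  have hxj : ∀ j, j ≠ 0 → x j = √(N j / n) := fun j hj => by simp [hxdef, hydef, hj]
  have hF : zeroSumPoly d p x ^ n ≤ Real.exp (3 ^ d) ^ m := by
    have h1 := wordSum_le hy hys.le hy1 d 0
    rw [← zeroSumPoly_eq_wordSum] at h1
    have h2 : zeroSumPoly d p x ≤ Real.exp (3 ^ d * s) := by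
      refine h1.trans ?_
      simp only [hydef, if_true, zero_add]
      linarith [Real.add_one_le_exp (3 ^ d * s)]
    refine (pow_le_pow_left₀ (zeroSumPoly_nonneg hx) h2 n).trans (le_of_eq ?_)
    rw [← Real.exp_nat_mul, ← Real.exp_nat_mul, hs]
    congr 1
    field_simp
  set Q : ℝ := ∏ j, x j ^ N j with hQdef
  have hQ0 : 0 < Q := by
    refine prod_pos fun j _ => ?_
    rcases Nat.eq_zero_or_pos (N j) with h | h
    · simp [h]
    · by_cases hj : j = 0
      · simp [hj, hx0]
      · have : (0 : ℝ) < N j := by exact_mod_cast h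
        rw [hxj j hj]
        positivity
  have hQ : Q ≤ √s ^ m := by
    rw [hQdef, ← mul_prod_erase univ _ (mem_univ 0), hx0, one_pow, one_mul, ← hmsum,
      ← prod_pow_eq_pow_sum]
    refine prod_le_prod (fun j _ => pow_nonneg (hx j) _) fun j hj => ?_
    rw [hxj j (ne_of_mem_erase hj)]
    gcongr
    rw [hs, ← hmsum]
    gcongr
    exact single_le_sum (f := N) (fun _ _ => Nat.zero_le _) hj
  have hQ1 : Q ≤ 1 := hQ.trans (pow_le_one₀ (Real.sqrt_nonneg _) (Real.sqrt_le_one.2 hmn))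
  have h1 := contribution_mul_le hd hn hN hx
  have h2 : ∏ j, x j ^ (d * N j) = Q ^ d := by
    rw [hQdef, ← prod_pow]
    exact prod_congr rfl fun j _ => by rw [← pow_mul, mul_comm]
  have h3 : ∏ j, ((N j : ℝ) / n) ^ ((d - 1) * N j) ≤ Q ^ (2 * (d - 1)) := by
    rw [hQdef, ← prod_pow]
    refine prod_le_prod (fun _ _ => by positivity) fun j _ => ?_
    rw [← pow_mul, show N j * (2 * (d - 1)) = 2 * ((d - 1) * N j) by ring, pow_mul (x j)]
    refine pow_le_pow_left₀ (by positivity) ?_ _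
    by_cases hj : j = 0
    · rw [hj, hx0, one_pow, div_le_one hn']
      exact_mod_cast (by omega : N 0 ≤ n)
    · rw [hxj j hj, Real.sq_sqrt (by positivity)]
  -- At most `m` nonzero letters occur, plus the letter 0, and `m + 1 ≤ 2m`. Hence the Stirling loss
  -- is `d ^ m` and not `√d ^ p`.
  have hK : #{j | N j ≠ 0} ≤ 2 * m := by
    have h4 : #{j | N j ≠ 0} ≤ #(insert 0 {j ∈ univ.erase (0 : ZMod p) | N j ≠ 0}) := by
      refine card_le_card fun j hj => ?_
      by_cases h : j = 0
      · simp [h]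
      · simpa [h] using hj
    have h5 : #{j ∈ univ.erase (0 : ZMod p) | N j ≠ 0} ≤ m := by
      rw [← hmsum, card_filter]
      refine sum_le_sum fun j _ => ?_
      split_ifs <;> omega
    have := card_insert_le (0 : ZMod p) {j ∈ univ.erase (0 : ZMod p) | N j ≠ 0}
    omega
  have hKd : √d ^ #{j | N j ≠ 0} ≤ (d : ℝ) ^ m := by
    refine (pow_le_pow_right₀ (Real.one_le_sqrt.2 hd1) hK).trans (le_of_eq ?_)
    rw [pow_mul, Real.sq_sqrt (by positivity)]
  have hF0 : 0 ≤ zeroSumPoly d p x ^ n := pow_nonneg (zeroSumPoly_nonneg hx) _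
  rw [h2] at h1
  have h4 : contribution d p n N ≤ √d ^ #{j | N j ≠ 0} * zeroSumPoly d p x ^ n * Q ^ (d - 2) := by
    refine le_of_mul_le_mul_right (h1.trans ?_) (pow_pos hQ0 d)
    rw [show √d ^ #{j | N j ≠ 0} * zeroSumPoly d p x ^ n * Q ^ (d - 2) * Q ^ d
      = √d ^ #{j | N j ≠ 0} * Q ^ (2 * (d - 1)) * zeroSumPoly d p x ^ n by
        rw [show 2 * (d - 1) = (d - 2) + d by omega, pow_add]
        ring]
    gcongr
  have h5 : Q ^ (d - 2) ≤ √s ^ m :=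
    (pow_le_of_le_one hQ0.le hQ1 (by omega)).trans hQ
  calc _ ≤ _ := h4
    _ ≤ (d : ℝ) ^ m * Real.exp (3 ^ d) ^ m * √s ^ m := by gcongr
    _ = _ := by rw [mul_pow, mul_pow]

/-! ### Counting tuples and summing their contributions. -/

theorem card_piAntidiag_le_card_pow (n : ℕ) :
    #(piAntidiag (univ : Finset (ZMod p)) n) ≤ p ^ n := by
  have h := sum_pow_eq_sum_piAntidiag (univ : Finset (ZMod p)) (fun _ => (1 : ℕ)) n
  simp only [sum_const, card_univ, ZMod.card, smul_eq_mul, mul_one, one_pow, prod_const_one,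
    Nat.cast_id] at h
  rw [h, card_eq_sum_ones]
  exact sum_le_sum fun k _ => Nat.multinomial_pos _ _

theorem card_piAntidiag_le_pow_card (n : ℕ) :
    #(piAntidiag (univ : Finset (ZMod p)) n) ≤ (n + 1) ^ p := by
  have h : piAntidiag (univ : Finset (ZMod p)) n ⊆ Fintype.piFinset fun _ => range (n + 1) := by
    intro N hN
    rw [mem_piAntidiag] at hN
    rw [Fintype.mem_piFinset]
    intro j
    rw [mem_range, Nat.lt_succ_iff, ← hN.1]
    exact single_le_sum (f := N) (fun _ _ => Nat.zero_le _) (mem_univ j)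
  simpa using card_le_card h

theorem card_filter_piAntidiag_le (n m : ℕ) :
    #{N ∈ piAntidiag (univ : Finset (ZMod p)) n | N 0 + m = n} ≤ p ^ m := by
  refine le_trans (card_le_card_of_injOn (fun N => Function.update N 0 0) ?_ ?_)
    (card_piAntidiag_le_card_pow m)
  · intro N hN
    simp only [coe_filter, mem_piAntidiag, Set.mem_ofPred_eq] at hN
    have h1 := add_sum_erase univ N (mem_univ 0)
    simp only [mem_coe, mem_piAntidiag, mem_univ, implies_true, and_true]
    rw [sum_update_of_mem (mem_univ _), zero_add, sdiff_singleton_eq_erase]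
    have h2 : ∑ j, N j = n := hN.1.1
    rw [h2] at h1
    omega
  · intro N hN N' hN' h
    simp only [coe_filter, mem_piAntidiag, Set.mem_ofPred_eq] at hN hN'
    funext j
    by_cases hj : j = 0
    · rw [hj]
      omega
    · simpa [hj] using congrFun h j

theorem sum_range_mul_half_pow_le (n : ℕ) :
    ∑ m ∈ range n, (m : ℝ) * (1 / 2) ^ m ≤ 2 := by
  have h : ∑ m ∈ range n, (m : ℝ) * (1 / 2) ^ m = 2 - (n + 1) * 2 * (1 / 2) ^ n := by
    induction n with
    | zero => simp
    | succ n ih =>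
      rw [sum_range_succ, ih]
      push_cast
      ring
  rw [h]
  have : (0 : ℝ) ≤ (n + 1) * 2 * (1 / 2) ^ n := by positivity
  linarith

/-- The growth rate of the contributions of count vectors close to `(n, 0, …, 0)`. -/
def nearRate (d : ℕ) : ℝ := d * Real.exp (3 ^ d)

theorem one_le_nearRate {d : ℕ} (hd : d ≠ 0) : 1 ≤ nearRate d := by
  have h1 : (1 : ℝ) ≤ d := by exact_mod_cast Nat.one_le_iff_ne_zero.2 hd
  have h2 : (1 : ℝ) ≤ Real.exp (3 ^ d) := Real.one_le_exp (by positivity)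
  rw [nearRate]
  nlinarith

/-- The hypothesis `hpm` says that `a = p A √(m/n)` is at most 1/2. One factor `a` is kept to supply
`p/√n`, and the other `m - 1` give the geometric decay. -/
theorem contribution_le_of_near {d n m : ℕ} (hd : 3 ≤ d) (hm : m ≠ 0)
    {N : ZMod p → ℕ} (hN : ∑ j, N j = n) (hNm : N 0 + m = n)
    (hpm : 4 * nearRate d ^ 2 * (p : ℝ) ^ 2 * m ≤ n) :
    (p : ℝ) ^ m * contribution d p n N ≤ 2 * (nearRate d * (p / √n)) * (m * (1 / 2) ^ m) := by
  have hA := one_le_nearRate (d := d) (by omega)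
  have hp1 : (1 : ℝ) ≤ p := by exact_mod_cast Nat.one_le_iff_ne_zero.2 (NeZero.ne p)
  have hn' : (0 : ℝ) < n := by exact_mod_cast (by omega : 0 < n)
  have hm1 : (1 : ℝ) ≤ m := by exact_mod_cast Nat.one_le_iff_ne_zero.2 hm
  have hpm' : p * m ≤ n := by
    have h1 : (p : ℝ) * m ≤ n := by
      refine le_trans ?_ hpm
      gcongr
      nlinarith [one_le_pow₀ hA (n := 2), mul_le_mul_of_nonneg_right hp1 (by linarith : 0 ≤ (p : ℝ))]
    exact_mod_cast h1
  have h1 := contribution_le_pow hd hm hN hNm hpm'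
  rw [← nearRate] at h1
  set a : ℝ := p * (nearRate d * √(m / n)) with ha
  have ha0 : 0 ≤ a := by positivity
  have ha2 : a ≤ 1 / 2 := by
    refine le_of_sq_le_sq ?_ (by norm_num)
    rw [ha, mul_pow, mul_pow, Real.sq_sqrt (by positivity), mul_div_assoc', mul_div_assoc',
      div_le_iff₀ hn']
    linarith
  obtain ⟨k, rfl⟩ := Nat.exists_eq_succ_of_ne_zero hm
  have hsq : √((k.succ : ℝ) / n) ≤ k.succ / √n := by
    rw [Real.sqrt_div (by positivity)]
    gcongr
    rw [Real.sqrt_le_iff]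
    constructor <;> nlinarith
  calc (p : ℝ) ^ k.succ * contribution d p n N
      ≤ (p : ℝ) ^ k.succ * (nearRate d * √(k.succ / n)) ^ k.succ := by gcongr
    _ = a * a ^ k := by rw [← mul_pow, ← ha, pow_succ' a]
    _ ≤ (p * (nearRate d * (k.succ / √n))) * (1 / 2) ^ k := by
        rw [ha] at ha0 ha2 ⊢
        gcongr
    _ = _ := by
        rw [pow_succ]
        ring

theorem sum_contribution_near_le {d n : ℕ} (hd : 3 ≤ d) :
    ∑ N ∈ piAntidiag (univ : Finset (ZMod p)) n with
        N 0 ≠ n ∧ 4 * nearRate d ^ 2 * (p : ℝ) ^ 2 * (n - N 0 : ℕ) ≤ n, contribution d p n N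
      ≤ 4 * (nearRate d * (p / √n)) := by
  classical
  have hp : (0 : ℝ) < p := by exact_mod_cast Nat.pos_of_ne_zero (NeZero.ne p)
  have hA := one_le_nearRate (d := d) (by omega)
  set T := {N ∈ piAntidiag (univ : Finset (ZMod p)) n |
    N 0 ≠ n ∧ 4 * nearRate d ^ 2 * (p : ℝ) ^ 2 * (n - N 0 : ℕ) ≤ n} with hT
  set B : ℝ := 2 * (nearRate d * (p / √n)) with hB
  have hB0 : 0 ≤ B := by positivity
  have hle : ∀ N ∈ T, N 0 ≤ n := by
    intro N hN
    rw [hT, mem_filter, mem_piAntidiag] at hN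
    rw [← hN.1.1]
    exact single_le_sum (f := N) (fun _ _ => Nat.zero_le _) (mem_univ 0)
  rw [← sum_fiberwise_of_maps_to (t := range (n + 1)) (g := fun N => n - N 0)
    (fun N _ => by rw [mem_range]; omega)]
  calc _ ≤ ∑ m ∈ range (n + 1), B * (m * (1 / 2) ^ m) := by
        refine sum_le_sum fun m _ => ?_
        have h1 : ∀ N ∈ {N ∈ T | n - N 0 = m}, contribution d p n N
            ≤ B * (m * (1 / 2) ^ m) / (p : ℝ) ^ m := by
          intro N hN
          obtain ⟨hNT, hNm⟩ := mem_filter.1 hN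
          have h0 := hle N hNT
          rw [hT, mem_filter, mem_piAntidiag, hNm] at hNT
          obtain ⟨⟨hNn, -⟩, hne, hpm⟩ := hNT
          rw [le_div_iff₀ (by positivity), mul_comm]
          exact contribution_le_of_near hd (by omega) hNn (by omega) hpm
        have h2 : #{N ∈ T | n - N 0 = m} ≤ p ^ m := by
          refine (card_le_card fun N hN => ?_).trans (card_filter_piAntidiag_le n m)
          rw [mem_filter] at hN ⊢
          exact ⟨(mem_filter.1 hN.1).1, by have := hle N hN.1; omega⟩
        calc _ ≤ _ := sum_le_card_nsmul _ _ _ h1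
          _ ≤ ((p ^ m : ℕ) : ℝ) * (B * (m * (1 / 2) ^ m) / (p : ℝ) ^ m) := by
              rw [nsmul_eq_mul]
              gcongr
          _ = _ := by
              push_cast
              field_simp
    _ ≤ B * 2 := by
        rw [← mul_sum]
        exact mul_le_mul_of_nonneg_left (sum_range_mul_half_pow_le _) hB0
    _ = _ := by
        rw [hB]
        ring

/-- Each term of the minimum is at least `4 p log n / (c n)`: the first by `hfar` and `hpn`, the
second by `hpn`, the third by non-equidistribution and `b ≥ 4/c`. The exponential is then at most `n
^ (-4p)`. -/
theorem contribution_le_of_far [Fact p.Prime] {d n : ℕ} (hd : 3 ≤ d) (hpd : ¬ p ∣ d) (hn : n ≠ 0)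
    {b : ℝ} (hb : 4 / youngConst d ≤ b)
    (hpn : 16 * nearRate d ^ 2 * (p : ℝ) ^ 3 * Real.log n ≤ youngConst d * n)
    {N : ZMod p → ℕ} (hN : ∑ j, N j = n) (hNb : ¬ Equidistributed b p n N)
    (hfar : (n : ℝ) < 4 * nearRate d ^ 2 * (p : ℝ) ^ 2 * (n - N 0 : ℕ)) :
    contribution d p n N ≤ (d / (n : ℝ) ^ 4) ^ p := by
  have hA := one_le_nearRate (d := d) (by omega)
  have hc := youngConst_pos hd
  have hp1 : (1 : ℝ) ≤ p := by exact_mod_cast Nat.one_le_iff_ne_zero.2 (NeZero.ne p)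
  have hn' : (0 : ℝ) < n := by exact_mod_cast Nat.pos_of_ne_zero hn
  have hn1 : (1 : ℝ) ≤ n := by exact_mod_cast Nat.one_le_iff_ne_zero.2 hn
  have hd1 : (1 : ℝ) ≤ d := by exact_mod_cast (by omega : 1 ≤ d)
  have hlog : 0 ≤ Real.log n := Real.log_nonneg hn1
  have hN0 : N 0 ≤ n := by
    rw [← hN]
    exact single_le_sum (f := N) (fun _ _ => Nat.zero_le _) (mem_univ 0)
  rw [Equidistributed, not_le] at hNb
  rw [Nat.cast_sub hN0] at hfar
  have hA2 : 1 ≤ nearRate d ^ 2 := one_le_pow₀ hA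
  set L := Real.log n
  set A := nearRate d
  set c := youngConst d
  have hmin : 4 * (p * L) / (c * n) ≤ min (1 - (N 0 : ℝ) / n)
      (min (1 / (p : ℝ) ^ 2) ((p : ℝ) * ∑ j, ((N j : ℝ) / n - 1 / p) ^ 2)) := by
    have hbase : 4 * (p * L) / (c * n) ≤ 1 / (4 * A ^ 2 * (p : ℝ) ^ 2) := by
      rw [div_le_div_iff₀ (by positivity) (by positivity)]
      calc _ = 16 * A ^ 2 * (p : ℝ) ^ 3 * L := by ring
        _ ≤ _ := by linarith
    refine le_min ?_ (le_min ?_ ?_)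
    · refine hbase.trans ?_
      rw [div_le_iff₀ (by positivity), one_sub_div hn'.ne', div_mul_eq_mul_div, le_div_iff₀ hn']
      linarith
    · refine hbase.trans (one_div_le_one_div_of_le (by positivity) ?_)
      have : 0 ≤ (p : ℝ) ^ 2 := by positivity
      nlinarith
    · calc 4 * (p * L) / (c * n) = p * (4 / c * L / n) := by field_simp
        _ ≤ p * (b * L / n) := by gcongr
        _ ≤ _ := by gcongr
  refine (contribution_le_exp hd hpd hn hN).trans ?_
  have hexp : Real.exp (-(n * (c * min (1 - (N 0 : ℝ) / n)
      (min (1 / (p : ℝ) ^ 2) ((p : ℝ) * ∑ j, ((N j : ℝ) / n - 1 / p) ^ 2)))))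
      ≤ ((n : ℝ) ^ 4)⁻¹ ^ p := by
    have h1 : ((n : ℝ) ^ 4)⁻¹ ^ p = Real.exp (-(n * (c * (4 * (p * L) / (c * n))))) := by
      rw [show n * (c * (4 * (p * L) / (c * n))) = p * ((4 : ℕ) * L) by push_cast; field_simp,
        Real.exp_neg, Real.exp_nat_mul, Real.exp_nat_mul, Real.exp_log hn', inv_pow]
    rw [h1]
    gcongr
  calc _ ≤ (d : ℝ) ^ p * ((n : ℝ) ^ 4)⁻¹ ^ p := by
        gcongr
        exact (Real.sqrt_le_left (by linarith)).2 (by nlinarith)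
    _ = _ := by rw [← mul_pow, div_eq_mul_inv]

theorem sum_contribution_errorTuples_le [Fact p.Prime] {d n : ℕ} (hd : 3 ≤ d) (hpd : ¬ p ∣ d)
    (hn : 2 ≤ n) (hdn : d ≤ n) {b : ℝ} (hb : 4 / youngConst d ≤ b)
    (hpn : 16 * nearRate d ^ 2 * (p : ℝ) ^ 3 * Real.log n ≤ youngConst d * n) :
    ∑ N ∈ errorTuples b p n, contribution d p n N ≤ 4 * (nearRate d * (p / √n)) + 1 / n := by
  classical
  have hn2 : (2 : ℝ) ≤ n := by exact_mod_cast hn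
  have hdn' : (d : ℝ) ≤ n := by exact_mod_cast hdn
  have hn' : (0 : ℝ) < n := by linarith
  have hmem : ∀ N ∈ errorTuples b p n, N ∈ piAntidiag (univ : Finset (ZMod p)) n ∧
      N ≠ Pi.single 0 n ∧ ¬ Equidistributed b p n N := fun N hN => by
    rw [errorTuples, mem_filter] at hN
    exact hN
  rw [← sum_filter_add_sum_filter_not (errorTuples b p n)
    fun N => 4 * nearRate d ^ 2 * (p : ℝ) ^ 2 * (n - N 0 : ℕ) ≤ n]
  refine add_le_add ?_ ?_
  · refine le_trans (sum_le_sum_of_subset_of_nonneg ?_ fun _ _ _ => contribution_nonneg _ _ _)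
      (sum_contribution_near_le hd)
    intro N hN
    rw [mem_filter] at hN ⊢
    obtain ⟨h1, h2, -⟩ := hmem N hN.1
    refine ⟨h1, fun h0 => h2 ?_, hN.2⟩
    rw [mem_piAntidiag] at h1
    have h3 := add_sum_erase univ N (mem_univ 0)
    have h5 : ∑ j, N j = n := h1.1
    rw [h5] at h3
    have h4 : ∑ j ∈ univ.erase (0 : ZMod p), N j = 0 := by omega
    rw [sum_eq_zero_iff] at h4
    funext j
    by_cases hj : j = 0
    · rw [hj, h0, Pi.single_eq_same]
    · rw [Pi.single_eq_of_ne hj]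
      exact h4 j (mem_erase.2 ⟨hj, mem_univ _⟩)
  · have h1 : ∀ N ∈ (errorTuples b p n).filter
        (fun N => ¬ 4 * nearRate d ^ 2 * (p : ℝ) ^ 2 * (n - N 0 : ℕ) ≤ n),
        contribution d p n N ≤ (d / (n : ℝ) ^ 4) ^ p := by
      intro N hN
      rw [mem_filter, not_le] at hN
      obtain ⟨h1, -, h2⟩ := hmem N hN.1
      exact contribution_le_of_far hd hpd (by omega) hb hpn (mem_piAntidiag.1 h1).1 h2 hN.2
    have h2 : #((errorTuples b p n).filter
        (fun N => ¬ 4 * nearRate d ^ 2 * (p : ℝ) ^ 2 * (n - N 0 : ℕ) ≤ n)) ≤ (n + 1) ^ p :=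
      (card_le_card fun N hN => (hmem N (mem_filter.1 hN).1).1).trans
        (card_piAntidiag_le_pow_card n)
    calc _ ≤ _ := sum_le_card_nsmul _ _ _ h1
      _ ≤ (((n + 1) ^ p : ℕ) : ℝ) * (d / (n : ℝ) ^ 4) ^ p := by
          rw [nsmul_eq_mul]
          gcongr
      _ = ((n + 1) * (d / (n : ℝ) ^ 4)) ^ p := by
          push_cast
          rw [mul_pow]
      _ ≤ (1 / (n : ℝ)) ^ p := by
          gcongr
          rw [mul_div_assoc', div_le_div_iff₀ (by positivity) hn']
          have h3 : (n + 1) * (d : ℝ) ≤ (n : ℝ) ^ 2 * n := by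
            gcongr
            nlinarith
          nlinarith
      _ ≤ 1 / n := by
          refine pow_le_of_le_one (by positivity) ?_ (NeZero.ne p)
          rw [div_le_one hn']
          linarith

/-! ### Asymptotics, uniform in `p`. -/

theorem eventually_rpow_mul_log_le {ε c C : ℝ} (hε : 0 < ε) (hc : 0 < c) :
    ∀ᶠ n : ℕ in Filter.atTop, C * (n : ℝ) ^ (1 - 3 * ε) * Real.log n ≤ c * n := by
  have h1 := (isLittleO_log_rpow_atTop (by positivity : 0 < 3 * ε)).def
    (c := c / (|C| + 1)) (by positivity)
  filter_upwards [tendsto_natCast_atTop_atTop.eventually h1, Filter.eventually_ge_atTop 1]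
    with n hn hn1
  have hn1' : (1 : ℝ) ≤ n := by exact_mod_cast hn1
  have hlog : 0 ≤ Real.log n := Real.log_nonneg hn1'
  rw [Real.norm_of_nonneg hlog, Real.norm_of_nonneg (by positivity)] at hn
  have h2 : (n : ℝ) ^ (1 - 3 * ε) * (n : ℝ) ^ (3 * ε) = n := by
    rw [← Real.rpow_add (by linarith), sub_add_cancel, Real.rpow_one]
  have h3 : (|C| + 1) * (c / (|C| + 1) * (n : ℝ) ^ (3 * ε)) = c * (n : ℝ) ^ (3 * ε) := by
    field_simp
  calc C * (n : ℝ) ^ (1 - 3 * ε) * Real.log n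
      ≤ (|C| + 1) * (n : ℝ) ^ (1 - 3 * ε) * (c / (|C| + 1) * (n : ℝ) ^ (3 * ε)) := by
        have : C ≤ |C| + 1 := (le_abs_self C).trans (by linarith)
        gcongr
    _ = (n : ℝ) ^ (1 - 3 * ε) * ((|C| + 1) * (c / (|C| + 1) * (n : ℝ) ^ (3 * ε))) := by ring
    _ = c * ((n : ℝ) ^ (1 - 3 * ε) * (n : ℝ) ^ (3 * ε)) := by rw [h3]; ring
    _ = c * n := by rw [h2]

end

theorem proposition2p3 (d : ℕ) (hd : 3 ≤ d) :
    ∃ b₀ : ℝ, 0 < b₀ ∧ ∀ b : ℝ, b₀ ≤ b → ∀ ε : ℝ, 0 < ε → ∀ η : ℝ, 0 < η →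
      ∃ n₀ : ℕ, ∀ n : ℕ, n₀ ≤ n → ∀ (p : ℕ) [Fact p.Prime], ¬ p ∣ d →
        (p : ℝ) ≤ (n : ℝ) ^ (1 / 3 - ε) →
          ∑ N ∈ errorTuples b p n, contribution d p n N ≤ η := by
  have hc := youngConst_pos hd
  have hA := one_le_nearRate (d := d) (by omega)
  refine ⟨4 / youngConst d, by positivity, fun b hb ε hε η hη => ?_⟩
  have h1 := eventually_rpow_mul_log_le (C := 16 * nearRate d ^ 2) hε hc
  have h2 : ∀ᶠ n : ℕ in Filter.atTop,
      4 * (nearRate d * (n : ℝ) ^ (-(1 / 6) : ℝ)) + 1 / n ≤ η := by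
    have h3 : Filter.Tendsto (fun n : ℕ => 4 * (nearRate d * (n : ℝ) ^ (-(1 / 6) : ℝ)) + 1 / n)
        Filter.atTop (nhds (4 * (nearRate d * 0) + 0)) :=
      ((((tendsto_rpow_neg_atTop (by norm_num : (0 : ℝ) < 1 / 6)).comp
        tendsto_natCast_atTop_atTop).const_mul _).const_mul _).add
        tendsto_one_div_atTop_nhds_zero_nat
    exact (h3.eventually (gt_mem_nhds (by simpa using hη))).mono fun n hn => hn.le
  obtain ⟨n₀, hn₀⟩ := Filter.eventually_atTop.1 (h1.and (h2.and
    ((Filter.eventually_ge_atTop 2).and (Filter.eventually_ge_atTop d))))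
  refine ⟨n₀, fun n hn p _ hpd hp => ?_⟩
  obtain ⟨hlog, hsmall, hn2, hdn⟩ := hn₀ n hn
  have hn' : (0 : ℝ) < n := by exact_mod_cast (by omega : 0 < n)
  have hn1 : (1 : ℝ) ≤ n := by exact_mod_cast (by omega : 1 ≤ n)
  have hlog0 : 0 ≤ Real.log n := Real.log_nonneg hn1
  have hp3 : (p : ℝ) ^ 3 ≤ (n : ℝ) ^ (1 - 3 * ε) := by
    refine (pow_le_pow_left₀ (Nat.cast_nonneg p) hp 3).trans (le_of_eq ?_)
    rw [← Real.rpow_mul_natCast hn'.le]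
    congr 1
    push_cast
    ring
  -- The exponent is `1/3 - 1/2 = -1/6`.
  have hps : (p : ℝ) / √n ≤ (n : ℝ) ^ (-(1 / 6) : ℝ) := by
    rw [div_le_iff₀ (Real.sqrt_pos.2 hn'), Real.sqrt_eq_rpow, ← Real.rpow_add hn']
    refine hp.trans (Real.rpow_le_rpow_of_exponent_le hn1 ?_)
    linarith
  refine (sum_contribution_errorTuples_le hd hpd hn2 hdn hb ?_).trans (le_trans ?_ hsmall)
  · refine le_trans ?_ hlog
    gcongr
  · gcongr
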